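/- Let $q$ be a prime power. Let $\mathbb S$ be a regular 2-spread of $\mathrm{PG}(8,q)$ with transversal plane $\Gamma$ in $\mathrm{PG}(8,q^3)$; that is, $\Gamma,\Gamma^q,\Gamma^{q^2}$ span $\mathrm{PG}(8,q^3)$, where $X^q$ is obtained from $X$ by raising coordinates to the power $q$. Identify $\mathrm{PG}(2,q^3)$ with $\Gamma$. A point $X\in\Gamma$ is represented by the spread plane $[\![X]\!]=\langle X,X^q,X^{q^2}\rangle\cap\mathrm{PG}(8,q)$ (the Bose representation). Let the line at infinity $\ell_\infty$ of $\mathrm{PG}(2,q^3)$ correspond to the line $g$ of $\Gamma$, put $\Sigma_\infty=\langle g,g^q,g^{q^2}\rangle\cap\mathrm{PG}(8,q)$ (a 5-space), and let $\Sigma_{6}\cong\mathrm{PG}(6,q)$ be a 6-space of $\mathrm{PG}(8,q)$ containing $\Sigma_\infty$. The exact-at-infinity Bruck–Bose representation of a point $X$ is $[X]=[\![X]\!]\cap\Sigma_{6}$: a point of $\Sigma_6\setminus\Sigma_\infty$ (an affine point) if $X\notin\ell_\infty$, and a plane of $\Sigma_\infty$ if $X\in\ell_\infty$. Let $\mathcal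 C$ be an $\mathbb F_q$-conic of $\mathrm{PG}(2,q^3)$, that is, a non-degenerate conic, with quadratic form $f$ over $\mathbb F_q$, of an $\mathbb F_q$-subplane $\pi$. Write the vectors representing points of $\mathrm{PG}(8,q)$ as triples $(y_0,y_1,y_2)\in\mathbb F_{q^3}^3$ with respect to a frame of $\pi$, so that the spread planes are the $\mathbb F_{q^3}$-lines. Let $\mathcal V([\![\mathcal C]\!])$ be the variety of $\mathrm{PG}(8,q)$ with equations $\theta(y_i)\theta'(y_j)=\theta(y_j)\theta'(y_i)$ and $f(\theta(y_0),\theta(y_1),\theta(y_2))=0$ for all $\mathbb F_q$-linear forms $\theta,\theta'$ on $\mathbb F_{q^3}$ and all $i,j$, and let $\mathcal V([\mathcal C])$ be the variety given by these equations and the linear equations of $\Sigma_6$. A variety over $\mathbb F_q$ is extended to $\mathrm{PG}(n,q^3)$ and $\mathrm{PG}(n,q^6)$ by taking the points there that satisfy the same equations; extensions are denoted by $^{\star}$ (to $q^3$) and $^{\star\star}$ (to $q^6$). A $k$-dim normal rational curve (nrc) is the image of $\{(s^k,s^{k-1}t,\dots,t^k) : (s:t)\in\mathrm{PG}(1,q)\}$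 under a projectivity over $\mathbb F_q$ onto a $k$-space; its extensions are the images under the same projectivity of the curves with $(s:t)\in\mathrm{PG}(1,q^3)$ and $(s:t)\in\mathrm{PG}(1,q^6)$. Then the point set $[\mathcal C]$ (the union of the $[X]$, $X\in\mathcal C$) is the set of points of $\mathcal V([\mathcal C])$ in $\mathrm{PG}(6,q)$, and $\mathcal V([\mathcal C])^{\star}=\mathcal V([\![\mathcal C]\!])^{\star}\cap\Sigma_6^{\star}$, $\mathcal V([\mathcal C])^{\star\star}=\mathcal V([\![\mathcal C]\!])^{\star\star}\cap\Sigma_6^{\star\star}$. Moreover there are an integer $k$ with $2\le k\le 6$, a $k$-dim nrc $\mathcal N_k$ in $\Sigma_6$ containing at least $q-1$ affine points, and a finite (possibly empty) list $S_1,\dots,S_m$, possibly with repetitions but with no member properly contained in another, of lines and planes of $\mathrm{PG}(8,q^6)$ contained in $\Sigma_\infty^{\star\star}$, with $\sum_{i}\dim S_i=6-k$, such that $$\mathcal V([\mathcal C])^{\star\star}=\mathcal N_k^{\star\star}\cup S_1\cup\dots\cup S_m,$$ $$\mathcal V([\mathcal C])^{\star}=\mathcal N_k^{\star}\cup\bigcup_i\bigl(S_i\cap\mathrm{PG}(8,q^3)\bigr),$$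 $$\mathcal V([\mathcal C])=\mathcal N_k\cup\bigcup_i\bigl(S_i\cap\mathrm{PG}(8,q)\bigr).$$ -/

import Mathlib

open scoped LinearAlgebra.Projectivization

namespace BoseBruck

noncomputable section

/-! ### Projective varieties over `F` and their variety-extensions -/

/-- A variety of `PG(n-1, F)`, given by its homogeneous equations with coefficients in `F`. -/
structure ProjVariety (F : Type*) [Field F] (n : ℕ) where
  eqs : Set (MvPolynomial (Fin n) F)
  homogeneous : ∀ p ∈ eqs, ∃ d : ℕ, p.IsHomogeneous d

/-- The variety-extension to an extension field `E`: the points of `PG(n-1, E)` that satisfy the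
same equations. For `E = F` this is the point set of the variety. -/
def ProjVariety.points {F : Type*} [Field F] {n : ℕ} (V : ProjVariety F n)
    (E : Type*) [Field E] [Algebra F E] : Set (ℙ E (Fin n → E)) :=
  {P | ∀ p ∈ V.eqs, MvPolynomial.aeval P.rep p = 0}

/-- The intersection of two varieties, given by the union of their equations. -/
def ProjVariety.inter {F : Type*} [Field F] {n : ℕ} (V W : ProjVariety F n) : ProjVariety F n where
  eqs := V.eqs ∪ W.eqs
  homogeneous := by
    rintro p (hp | hp)
    · exact V.homogeneous p hp
    · exact W.homogeneous p hp

/-- The linear polynomial `∑ u(e_m) X_m` of a linear form `u`. -/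
def linPoly {F : Type*} [Field F] {n : ℕ} (u : (Fin n → F) →ₗ[F] F) : MvPolynomial (Fin n) F :=
  ∑ m, MvPolynomial.C (u (Pi.single m 1)) * MvPolynomial.X m

theorem linPoly_isHomogeneous {F : Type*} [Field F] {n : ℕ} (u : (Fin n → F) →ₗ[F] F) :
    (linPoly u).IsHomogeneous 1 :=
  MvPolynomial.IsHomogeneous.sum _ _ _ fun m _ =>
    (MvPolynomial.isHomogeneous_X F m).C_mul _

/-- A subspace of `PG(n-1, F)` as a variety: the equations are all linear forms vanishing on it. -/
def linearVariety {F : Type*} [Field F] {n : ℕ} (U : Submodule F (Fin n → F)) :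
    ProjVariety F n where
  eqs := {p | ∃ u : (Fin n → F) →ₗ[F] F, (∀ x ∈ U, u x = 0) ∧ p = linPoly u}
  homogeneous := by
    rintro p ⟨u, -, rfl⟩
    exact ⟨1, linPoly_isHomogeneous u⟩

/-- The vector of `E^n` with the same coordinates as a vector of `F^n`. -/
def extVec {F : Type*} [Field F] (E : Type*) [Field E] [Algebra F E] {n : ℕ} (x : Fin n → F) :
    Fin n → E :=
  fun i => algebraMap F E (x i)

/-- The extension to `PG(n-1, E)` of a subspace of `PG(n-1, F)`. -/
def extSubspace {F : Type*} [Field F] (E : Type*) [Field E] [Algebra F E] {n : ℕ}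
    (U : Submodule F (Fin n → F)) : Submodule E (Fin n → E) :=
  Submodule.span E (extVec E '' (U : Set (Fin n → F)))

/-- The intersection with `PG(n-1, F)` of a subspace of `PG(n-1, E)`. -/
def subfieldPart (F : Type*) {E : Type*} [Field F] [Field E] [Algebra F E] {n : ℕ}
    (S : Submodule E (Fin n → E)) : Submodule F (Fin n → F) where
  carrier := {x | extVec E x ∈ S}
  zero_mem' := by
    have h : extVec E (0 : Fin n → F) = 0 := by funext i; simp [extVec]
    simp [h]
  add_mem' := by
    intro x y hx hy
    have h : extVec E (x + y) = extVec E x + extVec E y := by funext i; simp [extVec]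
    simpa [h] using S.add_mem hx hy
  smul_mem' := by
    intro c x hx
    have h : extVec E (c • x) = algebraMap F E c • extVec E x := by funext i; simp [extVec]
    simpa [h] using S.smul_mem (algebraMap F E c) hx

/-- The points of a subspace. -/
def pointsOf {E : Type*} [Field E] {n : ℕ} (S : Submodule E (Fin n → E)) :
    Set (ℙ E (Fin n → E)) :=
  {P | P.submodule ≤ S}

/-! ### Normal rational curves -/

/-- For linearly independent `e 0, …, e k` in `F^n`, the `k`-dimensional normal rational curve
`{⟨∑ i, s^(k-i) t^i e i⟩ | (s : t) ∈ PG(1, E)}`, that is, the image of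
`{(1, θ, …, θ^k) | θ ∈ E} ∪ {(0, …, 0, 1)}` under the projectivity with reference vectors `e`.
For `E = F` it is the normal rational curve of `PG(n-1, F)`; for an extension field `E` of `F`
it is the variety-extension of that curve to `PG(n-1, E)`. -/
def normalRationalCurve {F : Type*} [Field F] {n k : ℕ} (e : Fin (k + 1) → Fin n → F)
    (E : Type*) [Field E] [Algebra F E] : Set (ℙ E (Fin n → E)) :=
  {P | ∃ s t : E, (s ≠ 0 ∨ t ≠ 0) ∧
    P.submodule = E ∙ (∑ i : Fin (k + 1), (s ^ (k - (i : ℕ)) * t ^ (i : ℕ)) • extVec E (e i))}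

/-! ### `F`-conics of `PG(2, K)` -/

/-- An `F`-conic of `PG(2, K)`: a non-degenerate conic `f = 0` of the `F`-subplane which is the
image of `PG(2, F)` under the projectivity `frame`. The form `f` is non-degenerate when the conic
has no singular point; over a finite (hence perfect) field of any characteristic it is enough
to look at singular points over `F`. -/
structure SubConic (F K : Type*) [Field F] [Field K] [Algebra F K] where
  frame : (Fin 3 → K) ≃ₗ[K] (Fin 3 → K)
  f : MvPolynomial (Fin 3) F
  homogeneous : f.IsHomogeneous 2
  nonsingular : ∀ x : Fin 3 → F, x ≠ 0 → MvPolynomial.eval x f = 0 →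
    ∃ i, MvPolynomial.eval x (MvPolynomial.pderiv i f) ≠ 0

/-- The points of an `F`-conic. -/
def SubConic.points {F K : Type*} [Field F] [Field K] [Algebra F K] (C : SubConic F K) :
    Set (ℙ K (Fin 3 → K)) :=
  {P | ∃ x : Fin 3 → F, x ≠ 0 ∧ MvPolynomial.eval x C.f = 0 ∧
    P.submodule = K ∙ (C.frame (extVec K x))}

/-! ### The Bose representation of `PG(2, q^3)` in `PG(8, q)` -/

/-- The map `X ↦ X^q` on coordinate vectors, `q = |F|`. -/
def conj (F : Type*) {K : Type*} [Field K] {n : ℕ} (v : Fin n → K) : Fin n → K :=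
  fun i => v i ^ Nat.card F

theorem conj_add (F : Type*) {K : Type*} [Field F] [Finite F] [Field K] [Algebra F K] {n : ℕ}
    (v w : Fin n → K) : conj F (v + w) = conj F v + conj F w := by
  have : Fintype F := Fintype.ofFinite F
  funext i
  simpa [conj, Nat.card_eq_fintype_card] using
    (map_add (FiniteField.frobeniusAlgHom F K) (v i) (w i))

theorem conj_smul (F : Type*) {K : Type*} [Field K] {n : ℕ} (c : K) (v : Fin n → K) :
    conj F (c • v) = c ^ Nat.card F • conj F v := by
  funext i
  simp [conj, mul_pow]

theorem conj_sum (F : Type*) {K : Type*} [Field F] [Finite F] [Field K] [Algebra F K] {n : ℕ}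
    {ι : Type*} (s : Finset ι) (v : ι → Fin n → K) :
    conj F (∑ i ∈ s, v i) = ∑ i ∈ s, conj F (v i) := by
  have : Nat.card F ≠ 0 := Nat.card_ne_zero.2 ⟨⟨0⟩, inferInstance⟩
  have h0 : conj F (0 : Fin n → K) = 0 := by
    funext i
    simp [conj, this]
  let g : (Fin n → K) →+ (Fin n → K) :=
    { toFun := conj F, map_zero' := h0, map_add' := conj_add F }
  exact map_sum g v s

/-- The span `⟨U, U^q, U^(q^2)⟩`. -/
def conjSpan (F : Type*) {K : Type*} [Field K] {n : ℕ}
    (U : Submodule K (Fin n → K)) : Submodule K (Fin n → K) :=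
  Submodule.span K {w | ∃ v ∈ U, w = v ∨ w = conj F v ∨ w = conj F (conj F v)}

/-- A regular 2-spread of `PG(8, q)`, given by a transversal plane `Γ` of `PG(8, q^3)` such that
`Γ, Γ^q, Γ^(q^2)` span `PG(8, q^3)` (so `Γ` is disjoint from `PG(8, q)`), together with
an identification `φ` of `PG(2, q^3)` with `Γ`. -/
structure BoseRep (F K : Type*) [Field F] [Field K] [Algebra F K] where
  φ : (Fin 3 → K) →ₗ[K] (Fin 9 → K)
  span_conj : conjSpan F (LinearMap.range φ) = ⊤

namespace BoseRep

variable {F K : Type*} [Field F] [Field K] [Algebra F K]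

/-- For a subspace `U` of `PG(2, q^3)`, regarded in `Γ`, the subspace
`⟨U, U^q, U^(q^2)⟩ ∩ PG(8, q)`. If `U` is a point `X`, this is the spread plane of `X`; if `U` is
a line, it is a 5-space of the dual spread. -/
def rep (B : BoseRep F K) (U : Submodule K (Fin 3 → K)) : Submodule F (Fin 9 → F) :=
  subfieldPart F (conjSpan F (U.map B.φ))

/-- The map `y ↦ φ(y) + φ(y)^q + φ(y)^(q^2)` from `K^3` to `F^9`, written with the field trace. -/
def traceMap (B : BoseRep F K) : (Fin 3 → K) →ₗ[F] (Fin 9 → F) :=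
  LinearMap.pi fun m =>
    (Algebra.trace F K).comp ((LinearMap.proj m).comp (B.φ.restrictScalars F))

theorem extVec_traceMap [Finite F] (hK : Module.finrank F K = 3) (B : BoseRep F K)
    (y : Fin 3 → K) :
    extVec K (B.traceMap y) = B.φ y + conj F (B.φ y) + conj F (conj F (B.φ y)) := by
  have : FiniteDimensional F K := Module.finite_of_finrank_eq_succ hK
  have : Finite K := Module.finite_of_finite F
  funext m
  simp only [extVec, traceMap, LinearMap.pi_apply, LinearMap.comp_apply, LinearMap.proj_apply,
    LinearMap.restrictScalars_apply, FiniteField.algebraMap_trace_eq_sum_pow, hK,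
    Finset.sum_range_succ, Finset.sum_range_zero, conj, Pi.add_apply]
  simp [← pow_mul, sq]

theorem traceMap_bijective [Finite F] (hK : Module.finrank F K = 3) (B : BoseRep F K) :
    Function.Bijective B.traceMap := by
  have : FiniteDimensional F K := Module.finite_of_finrank_eq_succ hK
  have hinj : Function.Injective B.traceMap := by
    rw [← LinearMap.ker_eq_bot, LinearMap.ker_eq_bot']
    intro y hy
    -- the conjugates of `φ`, as linear maps
    let φ' : (Fin 3 → K) →ₗ[K] (Fin 9 → K) :=
      Fintype.linearCombination K fun i => conj F (B.φ (Pi.single i 1))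
    let φ'' : (Fin 3 → K) →ₗ[K] (Fin 9 → K) :=
      Fintype.linearCombination K fun i => conj F (conj F (B.φ (Pi.single i 1)))
    have hφ : ∀ v, B.φ v = ∑ i, v i • B.φ (Pi.single i 1) := fun v => by
      conv_lhs => rw [pi_eq_sum_univ' v]
      simp
    have h1 : ∀ v, conj F (B.φ v) = φ' (conj F v) := fun v => by
      rw [hφ v, conj_sum]
      simp [φ', Fintype.linearCombination_apply, conj_smul, conj]
    have h2 : ∀ v, conj F (conj F (B.φ v)) = φ'' (conj F (conj F v)) := fun v => by
      rw [hφ v, conj_sum, conj_sum]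
      simp [φ'', Fintype.linearCombination_apply, conj_smul, conj]
    let Φ : ((Fin 3 → K) × (Fin 3 → K)) × (Fin 3 → K) →ₗ[K] (Fin 9 → K) :=
      (B.φ.coprod φ').coprod φ''
    have hsurj : Function.Surjective Φ := by
      rw [← LinearMap.range_eq_top, ← top_le_iff, ← B.span_conj, conjSpan, Submodule.span_le]
      rintro w ⟨_, ⟨v, rfl⟩, rfl | rfl | rfl⟩
      · exact ⟨((v, 0), 0), by simp [Φ]⟩
      · exact ⟨((0, conj F v), 0), by simp [Φ, h1]⟩
      · exact ⟨((0, 0), conj F (conj F v)), by simp [Φ, h2]⟩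
    have hΦ : Function.Injective Φ :=
      (LinearMap.injective_iff_surjective_of_finrank_eq_finrank (by simp)).2 hsurj
    have h0 : Φ ((y, conj F y), conj F (conj F y)) = 0 := by
      have h := B.extVec_traceMap hK y
      rw [hy, h2, h1] at h
      simp only [Φ, LinearMap.coprod_apply]
      rw [← h]
      funext i
      simp [extVec]
    have h3 := hΦ (h0.trans (map_zero Φ).symm)
    exact congrArg (fun z => z.1.1) h3
  refine ⟨hinj, ?_⟩
  refine (LinearMap.injective_iff_surjective_of_finrank_eq_finrank ?_).1 hinj
  simp [Module.finrank_pi_fintype, hK]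

/-- Field reduction: `K^3` and `F^9` are identified so that the vector line of `y` over `K`
becomes the spread plane of the point `⟨y⟩`. -/
def traceEquiv [Finite F] (hK : Module.finrank F K = 3) (B : BoseRep F K) :
    (Fin 3 → K) ≃ₗ[F] (Fin 9 → F) :=
  LinearEquiv.ofBijective B.traceMap (B.traceMap_bijective hK)

/-- Let `y = (y_0, y_1, y_2) ∈ K^3` be the coordinates of a point of `PG(8, q)` with respect to
the frame of the subplane of `C`. For an `F`-linear form `θ` on `K`, this is the linear
polynomial over `F` in the coordinates of `PG(8, q)` that represents `θ(y_i)`. -/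
def coord [Finite F] (hK : Module.finrank F K = 3) (B : BoseRep F K) (C : SubConic F K)
    (θ : K →ₗ[F] F) (i : Fin 3) : MvPolynomial (Fin 9) F :=
  linPoly (θ.comp ((LinearMap.proj i).comp
    ((C.frame.symm.toLinearMap.restrictScalars F).comp (B.traceEquiv hK).symm.toLinearMap)))

/-- The variety formed by the points on the spread planes of the points of the `F`-conic `C`.
With `y` as in `coord`, the `y_i` are the rows of a `3 × 3` matrix over `F`. The spread planes of
the points of the subplane form the Segre variety `rank ≤ 1` (the quadrics
`θ(y_i) θ'(y_j) = θ(y_j) θ'(y_i)`), and those of the points of `C` are cut out on it by the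
quadrics `f(θ(y_0), θ(y_1), θ(y_2)) = 0`. Hence the points over an extension field `E` are the
`λ ⊗ c` with `λ ∈ PG(2, E)`, `c ∈ PG(2, E)`, `f(c) = 0`. -/
def conicVariety [Finite F] (hK : Module.finrank F K = 3) (B : BoseRep F K) (C : SubConic F K) :
    ProjVariety F 9 where
  eqs := {p | ∃ (θ θ' : K →ₗ[F] F) (i j : Fin 3),
      p = B.coord hK C θ i * B.coord hK C θ' j - B.coord hK C θ j * B.coord hK C θ' i} ∪
    {p | ∃ θ : K →ₗ[F] F, p = MvPolynomial.aeval (B.coord hK C θ) C.f}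
  homogeneous := by
    rintro p (⟨θ, θ', i, j, rfl⟩ | ⟨θ, rfl⟩)
    · exact ⟨2, ((linPoly_isHomogeneous _).mul (linPoly_isHomogeneous _)).sub
        ((linPoly_isHomogeneous _).mul (linPoly_isHomogeneous _))⟩
    · exact ⟨1 * 2, C.homogeneous.aeval _ fun i => linPoly_isHomogeneous _⟩

/-! ### The exact-at-infinity Bruck–Bose representation, inside the Bose representation -/

/-- `[C]`, for a 6-space `Sg` of `PG(8, q)` through the 5-space at infinity: the points of `Sg`
on the spread planes of the points of `C`. -/
def bruckBose (B : BoseRep F K) (Sg : Submodule F (Fin 9 → F)) (C : SubConic F K) :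
    Set (ℙ F (Fin 9 → F)) :=
  {P | P ∈ pointsOf Sg ∧ ∃ X ∈ C.points, P ∈ pointsOf (B.rep X.submodule)}

/-- The variety `V([C])`: the section of `conicVariety` by the 6-space `Sg`. -/
def bruckBoseVariety [Finite F] (hK : Module.finrank F K = 3) (B : BoseRep F K)
    (Sg : Submodule F (Fin 9 → F)) (C : SubConic F K) : ProjVariety F 9 :=
  (B.conicVariety hK C).inter (linearVariety Sg)

end BoseRep

end

end BoseBruck

open BoseBruck

/-!
# The Bruck–Bose representation of an `F`-conic of `PG(2, q^3)`

Field reduction identifies `F^9` with `K^3`, so that the spread planes are the lines of vectors over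
`K`. Over `L` the algebra `K ⊗ L` splits by the three embeddings `x ↦ x^(q^j)` of `K`, and a vector
of `L^9` becomes a triple of vectors of `L^3` (`psi`). The points of the conic variety are then the
pure tensors `l ⊗ c` with `c` on the conic (`mem_conicVariety_iff_psi`).

A nonsingular conic over a finite field has a rational point off the line at infinity; in
coordinates adapted to such a point (`exists_conic_basis`, `exists_normalForm`) the conic is
`(1, x, x^2)` with `(0, 0, 1)`, and the equation of the line at infinity restricts to a monic
quadratic polynomial `H` over `K`. With `H_j` its conjugates, the 6-space is given by the condition
that `l_j H_j(x)` does not depend on `j`.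

Let `M = H Q` be the least common multiple of the conjugates of `H`, a polynomial over `F`
(`exists_cofactor`). If the common value of `l_j H_j(x)` is not zero, then `l` is proportional to
`(Q_j(x))_j`, so the point lies on the curve `Q(x) (1, x, x^2)` of degree `k = deg M`. If it is
zero, then `l` is supported on the set of those `j` with `H_j(x) = 0`; these `l` form a point of
the same curve if the set has one element, and a line or a plane if it has two or three. Hence
the lines and planes lie above the common zeros of two conjugates of `H`
(`mem_normalRationalCurve_or_mem_fiberAtInfinity`). Counting them against `deg M` amounts to
listing the ways in which the Frobenius map can act on the roots of `H` (`roots_trichotomy`).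

The curve is a normal rational curve, that is, its `k + 1` coefficient vectors are independent
(`linearIndependent_curveVec`): the conjugates of `Q` have no common zero, so by Bézout the
products of the `Q_j` with polynomials of degree at most `2` span all polynomials of degree at most
`k`.

The statements over `F` and `K` follow from the one over `L`, because a point of the extended curve
with coordinates in a subfield has its parameter in that subfield (`points_eq_of_points_eq`).
-/

open scoped LinearAlgebra.Projectivization

namespace BoseBruck

/-! ### Extension of linear forms and descent of points -/

section Extension

variable {F E : Type*} [Field F] [Field E] [Algebra F E] {n : ℕ}

/-- The `E`-linear form on `E^n` extending an `F`-linear map `F^n → E`. -/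
noncomputable def extForm (g : (Fin n → F) →ₗ[F] E) : (Fin n → E) →ₗ[E] E :=
  Fintype.linearCombination E fun m => g (Pi.single m 1)

theorem extForm_apply (g : (Fin n → F) →ₗ[F] E) (v : Fin n → E) :
    extForm g v = ∑ m, v m * g (Pi.single m 1) := by
  simp [extForm, Fintype.linearCombination_apply]

theorem extForm_extVec (g : (Fin n → F) →ₗ[F] E) (x : Fin n → F) :
    extForm g (extVec E x) = g x := by
  conv_rhs => rw [pi_eq_sum_univ' x, map_sum]
  simp only [extForm_apply, extVec, map_smul]
  simp only [Algebra.smul_def]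

theorem extForm_eq_sum {ι : Type*} (s : Finset ι) (a : ι → E) (g : ι → (Fin n → F) →ₗ[F] E)
    (g' : (Fin n → F) →ₗ[F] E) (h : ∀ x, g' x = ∑ i ∈ s, a i * g i x) (v : Fin n → E) :
    extForm g' v = ∑ i ∈ s, a i * extForm (g i) v := by
  simp only [extForm_apply, h, Finset.mul_sum]
  rw [Finset.sum_comm]
  exact Finset.sum_congr rfl fun _ _ => Finset.sum_congr rfl fun _ _ => by ring

/-- A linear form over `F`, with values regarded in `E`. -/
noncomputable def toExt (E : Type*) [Field E] [Algebra F E] {M : Type*} [AddCommGroup M]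
    [Module F M] (u : M →ₗ[F] F) : M →ₗ[F] E :=
  (Algebra.linearMap F E).comp u

@[simp] theorem toExt_apply {M : Type*} [AddCommGroup M] [Module F M] (u : M →ₗ[F] F) (x : M) :
    toExt E u x = algebraMap F E (u x) := rfl

theorem aeval_linPoly (u : (Fin n → F) →ₗ[F] F) (v : Fin n → E) :
    MvPolynomial.aeval v (linPoly u) = extForm (toExt E u) v := by
  simp [linPoly, extForm_apply, mul_comm]

/-- The extension of a subspace is cut out by the same linear equations over `F`. -/
theorem mem_extSubspace_iff (U : Submodule F (Fin n → F)) (v : Fin n → E) :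
    v ∈ extSubspace E U ↔
      ∀ u : (Fin n → F) →ₗ[F] F, (∀ x ∈ U, u x = 0) → extForm (toExt E u) v = 0 := by
  constructor
  · intro hv u hu
    have : extSubspace E U ≤ LinearMap.ker (extForm (toExt E u)) := by
      rw [extSubspace, Submodule.span_le]
      rintro _ ⟨x, hx, rfl⟩
      simp [extForm_extVec, hu x hx]
    exact this hv
  · intro hv
    obtain ⟨W, hW⟩ := U.exists_isCompl
    -- the projection onto `U` along a complement, coordinate by coordinate
    let p : (Fin n → F) →ₗ[F] (Fin n → F) := U.subtype.comp (U.projectionOnto W hW)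
    have hp : ∀ x ∈ U, p x = x := fun x hx => by
      simp [p, Submodule.projectionOnto_apply_left hW ⟨x, hx⟩]
    have hpU : ∀ x, p x ∈ U := fun x => (U.projectionOnto W hW x).2
    have key : v = ∑ m, v m • extVec E (p (Pi.single m 1)) := by
      funext i
      have h := hv ((LinearMap.proj i).comp (LinearMap.id - p)) fun x hx => by simp [hp x hx]
      rw [extForm_apply] at h
      simp only [toExt_apply, LinearMap.comp_apply, LinearMap.sub_apply, LinearMap.id_apply,
        map_sub, LinearMap.proj_apply, mul_sub, Finset.sum_sub_distrib,
        Pi.single_apply] at h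
      simp only [MonoidWithZeroHom.map_ite_one_zero, mul_ite, mul_one, mul_zero,
        Finset.sum_ite_eq, Finset.mem_univ, if_true] at h
      simp only [Finset.sum_apply, Pi.smul_apply, smul_eq_mul, extVec]
      exact sub_eq_zero.1 h
    rw [key]
    exact Submodule.sum_mem _ fun m _ => Submodule.smul_mem _ _
      (Submodule.subset_span ⟨_, hpU _, rfl⟩)

theorem extVec_injective : Function.Injective (extVec (F := F) E : (Fin n → F) → Fin n → E) :=
  fun _ _ h => funext fun i => (algebraMap F E).injective (congrFun h i)

theorem mk_mem_pointsOf {S : Submodule E (Fin n → E)} {v : Fin n → E} (hv : v ≠ 0) :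
    Projectivization.mk E v hv ∈ pointsOf S ↔ v ∈ S := by
  simp [pointsOf, Projectivization.submodule_mk]

theorem mem_pointsOf {S : Submodule E (Fin n → E)} {P : ℙ E (Fin n → E)} :
    P ∈ pointsOf S ↔ P.rep ∈ S := by
  conv_lhs => rw [← P.mk_rep]
  exact mk_mem_pointsOf P.rep_nonzero

theorem linearVariety_points (U : Submodule F (Fin n → F)) :
    (linearVariety U).points E = pointsOf (extSubspace E U) := by
  ext P
  rw [mem_pointsOf, mem_extSubspace_iff]
  constructor
  · intro h u hu
    rw [← aeval_linPoly]
    exact h _ ⟨u, hu, rfl⟩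
  · rintro h p ⟨u, hu, rfl⟩
    rw [aeval_linPoly]
    exact h u hu

theorem inter_points (V W : ProjVariety F n) :
    (V.inter W).points E = V.points E ∩ W.points E := by
  ext P
  simp only [ProjVariety.points, ProjVariety.inter, Set.mem_inter_iff, Set.mem_ofPred_eq,
    Set.mem_union]
  exact ⟨fun h => ⟨fun p hp => h p (.inl hp), fun p hp => h p (.inr hp)⟩,
    fun h p hp => hp.elim (h.1 p) (h.2 p)⟩

theorem aeval_smul_of_isHomogeneous {p : MvPolynomial (Fin n) F} {d : ℕ} (hp : p.IsHomogeneous d)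
    (c : E) (v : Fin n → E) :
    MvPolynomial.aeval (c • v) p = c ^ d * MvPolynomial.aeval v p := by
  simp only [MvPolynomial.aeval_def, MvPolynomial.eval₂_eq', Finset.mul_sum]
  refine Finset.sum_congr rfl fun m hm => ?_
  have hd : m.degree = d := by
    have := hp (MvPolynomial.mem_support_iff.1 hm)
    rwa [Finsupp.degree_eq_weight_one]
  have : ∏ i, (c • v) i ^ m i = c ^ d * ∏ i, v i ^ m i := by
    simp only [Pi.smul_apply, smul_eq_mul, mul_pow, Finset.prod_mul_distrib]
    rw [Finset.prod_pow_eq_pow_sum, ← hd, Finsupp.degree_eq_sum]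
  rw [this]
  ring

theorem mk_mem_points (V : ProjVariety F n) {v : Fin n → E} (hv : v ≠ 0) :
    Projectivization.mk E v hv ∈ V.points E ↔ ∀ p ∈ V.eqs, MvPolynomial.aeval v p = 0 := by
  obtain ⟨a, ha⟩ := Projectivization.exists_smul_eq_mk_rep E v hv
  refine forall₂_congr fun p hp => ?_
  obtain ⟨d, hd⟩ := V.homogeneous p hp
  have : MvPolynomial.aeval (Projectivization.mk E v hv).rep p =
      (a : E) ^ d * MvPolynomial.aeval v p := by
    rw [← ha, ← aeval_smul_of_isHomogeneous hd]; rfl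
  rw [this]
  simp

theorem mk_mem_normalRationalCurve {k : ℕ} (e : Fin (k + 1) → Fin n → F) {v : Fin n → E}
    (hv : v ≠ 0) : Projectivization.mk E v hv ∈ normalRationalCurve e E ↔
      (∃ x c : E, v = c • ∑ i : Fin (k + 1), x ^ (i : ℕ) • extVec E (e i)) ∨
        ∃ c : E, v = c • extVec E (e (Fin.last k)) := by
  simp only [normalRationalCurve, Set.mem_ofPred_eq, Projectivization.submodule_mk]
  have h0 : ∀ t : E, ∑ i : Fin (k + 1), ((0 : E) ^ (k - (i : ℕ)) * t ^ (i : ℕ)) • extVec E (e i) =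
      t ^ k • extVec E (e (Fin.last k)) := fun t => by
    rw [Finset.sum_eq_single (Fin.last k)]
    · simp
    · intro i _ hi
      have : (i : ℕ) < k := Fin.val_lt_last hi
      rw [zero_pow (by omega), zero_mul, zero_smul]
    · simp
  constructor
  · rintro ⟨s, t, hst, h⟩
    obtain ⟨z, hz⟩ := Submodule.span_singleton_eq_span_singleton.1 h.symm
    rcases eq_or_ne s 0 with rfl | hs
    · right
      refine ⟨(z : E) * t ^ k, ?_⟩
      rw [← hz, h0, mul_smul]; rfl
    · left
      refine ⟨t / s, (z : E) * s ^ k, ?_⟩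
      rw [← hz, mul_smul, Finset.smul_sum (r := s ^ k)]
      refine congrArg (fun w : Fin n → E => (z : E) • w) ?_
      refine Finset.sum_congr rfl fun i _ => ?_
      rw [smul_smul]
      congr 1
      have : (i : ℕ) ≤ k := by omega
      rw [div_pow, ← pow_sub_mul_pow s this]
      field_simp
  · rintro (⟨x, c, h⟩ | ⟨c, h⟩)
    · have hc : c ≠ 0 := by rintro rfl; simp [h] at hv
      refine ⟨1, x, .inl one_ne_zero, (Submodule.span_singleton_eq_span_singleton.2
        ⟨Units.mk0 c hc, ?_⟩).symm⟩
      simp [h, Units.smul_def]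
    · have hc : c ≠ 0 := by rintro rfl; simp [h] at hv
      refine ⟨0, 1, .inr one_ne_zero, (Submodule.span_singleton_eq_span_singleton.2
        ⟨Units.mk0 c hc, ?_⟩).symm⟩
      rw [h0, h, one_pow, one_smul]
      rfl

theorem mem_normalRationalCurve {k : ℕ} (e : Fin (k + 1) → Fin n → F) {P : ℙ E (Fin n → E)} :
    P ∈ normalRationalCurve e E ↔
      (∃ x c : E, P.rep = c • ∑ i : Fin (k + 1), x ^ (i : ℕ) • extVec E (e i)) ∨
        ∃ c : E, P.rep = c • extVec E (e (Fin.last k)) := by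
  conv_lhs => rw [← P.mk_rep]
  exact mk_mem_normalRationalCurve e P.rep_nonzero

/-- A dual family to linearly independent vectors. -/
theorem exists_dual_of_linearIndependent {ι : Type*} [DecidableEq ι] {e : ι → Fin n → F}
    (he : LinearIndependent F e) :
    ∃ u : ι → (Fin n → F) →ₗ[F] F, ∀ i j, u i (e j) = if i = j then 1 else 0 := by
  have h : ∀ i, ∃ u : (Fin n → F) →ₗ[F] F, ∀ j, u (e j) = if i = j then 1 else 0 := fun i => by
    obtain ⟨g, hg⟩ := LinearMap.exists_extend
      ((Finsupp.lapply i).comp he.repr : Submodule.span F (Set.range e) →ₗ[F] F)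
    refine ⟨g, fun j => ?_⟩
    have hj := LinearMap.congr_fun hg ⟨e j, Submodule.subset_span ⟨j, rfl⟩⟩
    simp only [LinearMap.comp_apply, Submodule.subtype_apply] at hj
    rw [hj, he.repr_eq_single j _ rfl]
    simp [Finsupp.single_apply, eq_comm]
  choose u hu using h
  exact ⟨u, hu⟩

theorem extForm_sum_smul_dual {ι : Type*} [Fintype ι] [DecidableEq ι] {e : ι → Fin n → F}
    {u : ι → (Fin n → F) →ₗ[F] F} (hu : ∀ i j, u i (e j) = if i = j then 1 else 0)
    (a : ι → E) (i : ι) : extForm (toExt E (u i)) (∑ j, a j • extVec E (e j)) = a i := by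
  simp [map_sum, extForm_extVec, hu]

end Extension

section Descent

variable {F K L : Type*} [Field F] [Field K] [Field L] [Algebra F K] [Algebra F L] [Algebra K L]
  [IsScalarTower F K L] {n : ℕ}

theorem extVec_extVec (x : Fin n → F) : extVec L (extVec K x) = extVec L x := by
  funext i; simp [extVec, ← IsScalarTower.algebraMap_apply]

theorem extVec_sum_smul {ι : Type*} (s : Finset ι) (a : ι → K) (v : ι → Fin n → F) :
    extVec L (∑ i ∈ s, a i • extVec K (v i)) = ∑ i ∈ s, algebraMap K L (a i) • extVec L (v i) := by
  funext j; simp [extVec, IsScalarTower.algebraMap_apply F K L, Algebra.smul_def]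

theorem extVec_smul (a : K) (v : Fin n → K) :
    extVec L (a • v) = algebraMap K L a • extVec L v := by
  funext j; simp [extVec]

theorem extVec_ne_zero {v : Fin n → K} (hv : v ≠ 0) : extVec L v ≠ 0 := fun h =>
  hv (extVec_injective (E := L) (h.trans (by funext i; simp [extVec])))

/-- A point of `PG(n-1, K)`, regarded as a point of `PG(n-1, L)`. -/
noncomputable def extPoint (L : Type*) [Field L] [Algebra K L] (P : ℙ K (Fin n → K)) :
    ℙ L (Fin n → L) :=
  Projectivization.mk L (extVec L P.rep) (extVec_ne_zero P.rep_nonzero)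

theorem extPoint_mem_points (V : ProjVariety F n) (P : ℙ K (Fin n → K)) :
    extPoint L P ∈ V.points L ↔ P ∈ V.points K := by
  rw [extPoint, mk_mem_points]
  refine forall₂_congr fun p _ => ?_
  have : MvPolynomial.aeval (extVec L P.rep) p = algebraMap K L (MvPolynomial.aeval P.rep p) :=
    MvPolynomial.aeval_algebraMap_apply L P.rep p
  rw [this, map_eq_zero]

theorem extPoint_mem_pointsOf (S : Submodule L (Fin n → L)) (P : ℙ K (Fin n → K)) :
    extPoint L P ∈ pointsOf S ↔ P ∈ pointsOf (subfieldPart K S) := by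
  rw [extPoint, mk_mem_pointsOf, mem_pointsOf]
  rfl

/-- A point of the extended normal rational curve with coordinates in a subfield has its
parameter in the subfield, since coordinates on the `k`-space of the curve recover it. -/
theorem extPoint_mem_normalRationalCurve {k : ℕ} (hk : 1 ≤ k) {e : Fin (k + 1) → Fin n → F}
    (he : LinearIndependent F e) (P : ℙ K (Fin n → K)) :
    extPoint L P ∈ normalRationalCurve e L ↔ P ∈ normalRationalCurve e K := by
  rw [extPoint, mk_mem_normalRationalCurve, mem_normalRationalCurve]
  obtain ⟨u, hu⟩ := exists_dual_of_linearIndependent he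
  have hres : ∀ i, extForm (toExt L (u i)) (extVec L P.rep) =
      algebraMap K L (extForm (toExt K (u i)) P.rep) := fun i => by
    simp [extForm_apply, extVec, ← IsScalarTower.algebraMap_apply]
  constructor
  · rintro (⟨x, c, h⟩ | ⟨c, h⟩)
    · left
      have hc : ∀ i : Fin (k + 1), algebraMap K L (extForm (toExt K (u i)) P.rep) = c * x ^ (i : ℕ) :=
        fun i => by
          rw [← hres, h, map_smul, extForm_sum_smul_dual hu (fun i => x ^ (i : ℕ)), smul_eq_mul]
      have hc0 : c ≠ 0 := by
        rintro rfl
        exact extVec_ne_zero (L := L) P.rep_nonzero (by simpa using h)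
      set c' := extForm (toExt K (u 0)) P.rep with hc'
      set d' := extForm (toExt K (u ⟨1, by omega⟩)) P.rep with hd'
      have h1 : algebraMap K L c' = c := by simpa using hc 0
      have h2 : algebraMap K L d' = c * x := by simpa using hc ⟨1, by omega⟩
      have hx : algebraMap K L (d' / c') = x := by
        rw [map_div₀, h1, h2]; field_simp
      refine ⟨d' / c', c', extVec_injective (E := L) ?_⟩
      rw [extVec_smul, extVec_sum_smul, h, h1]
      simp [hx]
    · right
      refine ⟨extForm (toExt K (u (Fin.last k))) P.rep, extVec_injective (E := L) ?_⟩
      rw [extVec_smul, extVec_extVec, ← hres, h, map_smul, extForm_extVec]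
      simp [hu]
  · rintro (⟨x, c, h⟩ | ⟨c, h⟩)
    · left
      refine ⟨algebraMap K L x, algebraMap K L c, ?_⟩
      rw [h, extVec_smul, extVec_sum_smul]
      simp
    · right
      exact ⟨algebraMap K L c, by rw [h, extVec_smul, extVec_extVec]⟩

/-- A decomposition of the points over `L` of a variety over `F` into a normal rational curve and
subspaces descends to the points over an intermediate field. -/
theorem points_eq_of_points_eq (V : ProjVariety F n) {k : ℕ} (hk : 1 ≤ k)
    {e : Fin (k + 1) → Fin n → F} (he : LinearIndependent F e) {ι : Type*}
    (S : ι → Submodule L (Fin n → L))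
    (h : V.points L = normalRationalCurve e L ∪ ⋃ i, pointsOf (S i)) :
    V.points K = normalRationalCurve e K ∪ ⋃ i, pointsOf (subfieldPart K (S i)) := by
  ext P
  rw [← extPoint_mem_points (L := L), h]
  simp [extPoint_mem_pointsOf, extPoint_mem_normalRationalCurve hk he]

end Descent

/-! ### Field reduction: spread planes and the conic variety -/

/-- Under field reduction, the subspace representing `U` is `U` itself, because `Γ` and its
conjugates are independent. -/
theorem BoseRep.mem_rep_iff {F K : Type*} [Field F] [Finite F] [Field K] [Algebra F K]
    (hK : Module.finrank F K = 3) (B : BoseRep F K) (U : Submodule K (Fin 3 → K))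
    (w : Fin 9 → F) : w ∈ B.rep U ↔ (B.traceEquiv hK).symm w ∈ U := by
  obtain ⟨y, rfl⟩ := (B.traceEquiv hK).surjective w
  rw [LinearEquiv.symm_apply_apply]
  change extVec K (B.traceMap y) ∈ conjSpan F (U.map B.φ) ↔ _
  rw [B.extVec_traceMap hK]
  let φ' : (Fin 3 → K) →ₗ[K] (Fin 9 → K) :=
    Fintype.linearCombination K fun i => conj F (B.φ (Pi.single i 1))
  let φ'' : (Fin 3 → K) →ₗ[K] (Fin 9 → K) :=
    Fintype.linearCombination K fun i => conj F (conj F (B.φ (Pi.single i 1)))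
  have hφ : ∀ v, B.φ v = ∑ i, v i • B.φ (Pi.single i 1) := fun v => by
    conv_lhs => rw [pi_eq_sum_univ' v]
    simp
  have h1 : ∀ v, conj F (B.φ v) = φ' (conj F v) := fun v => by
    rw [hφ v, conj_sum]
    simp [φ', Fintype.linearCombination_apply, conj_smul, conj]
  have h2 : ∀ v, conj F (conj F (B.φ v)) = φ'' (conj F (conj F v)) := fun v => by
    rw [hφ v, conj_sum, conj_sum]
    simp [φ'', Fintype.linearCombination_apply, conj_smul, conj]
  let Φ : ((Fin 3 → K) × (Fin 3 → K)) × (Fin 3 → K) →ₗ[K] (Fin 9 → K) :=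
    (B.φ.coprod φ').coprod φ''
  have hsurj : Function.Surjective Φ := by
    rw [← LinearMap.range_eq_top, ← top_le_iff, ← B.span_conj, conjSpan, Submodule.span_le]
    rintro w ⟨_, ⟨v, rfl⟩, rfl | rfl | rfl⟩
    · exact ⟨((v, 0), 0), by simp [Φ]⟩
    · exact ⟨((0, conj F v), 0), by simp [Φ, h1]⟩
    · exact ⟨((0, 0), conj F (conj F v)), by simp [Φ, h2]⟩
  have hΦ : Function.Injective Φ :=
    (LinearMap.injective_iff_surjective_of_finrank_eq_finrank (by simp)).2 hsurj
  constructor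
  · intro h
    -- only the component along `Γ` of the span of `U` and its conjugates matters
    have hle : conjSpan F (U.map B.φ) ≤ ((U.prod ⊤).prod ⊤).map Φ := by
      rw [conjSpan, Submodule.span_le]
      rintro w ⟨_, ⟨v, hv, rfl⟩, rfl | rfl | rfl⟩
      · exact ⟨((v, 0), 0), by simpa using hv, by simp [Φ]⟩
      · exact ⟨((0, conj F v), 0), by simp, by simp [Φ, h1]⟩
      · exact ⟨((0, 0), conj F (conj F v)), by simp, by simp [Φ, h2]⟩
    obtain ⟨⟨⟨u, a⟩, b⟩, hu, hub⟩ := hle h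
    have h0 : Φ ((y, conj F y), conj F (conj F y)) =
        B.φ y + conj F (B.φ y) + conj F (conj F (B.φ y)) := by
      rw [h2, h1]
      simp [Φ]
    have h3 := hΦ (hub.trans h0.symm)
    have h4 : u = y := congrArg (fun z => z.1.1) h3
    rw [← h4]
    exact hu.1.1
  · intro hy
    have hm : B.φ y ∈ U.map B.φ := ⟨y, hy, rfl⟩
    exact add_mem (add_mem (Submodule.subset_span ⟨_, hm, .inl rfl⟩)
      (Submodule.subset_span ⟨_, hm, .inr (.inl rfl)⟩))
      (Submodule.subset_span ⟨_, hm, .inr (.inr rfl)⟩)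

section Rows

variable {F K E : Type*} [Field F] [Field K] [Field E] [Algebra F K] [Algebra F E] {n : ℕ}

/-- The `i`-th coordinate in `K`, for an identification `Y` of `F^n` with `K^3`. -/
def row (Y : (Fin n → F) ≃ₗ[F] (Fin 3 → K)) (i : Fin 3) : (Fin n → F) →ₗ[F] K :=
  (LinearMap.proj i).comp Y.toLinearMap

@[simp] theorem row_apply (Y : (Fin n → F) ≃ₗ[F] (Fin 3 → K)) (i : Fin 3) (w : Fin n → F) :
    row Y i w = Y w i := rfl

/-- The extensions of the forms `θ(Y_i)` are a full set of coordinates over `E`. -/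
theorem eq_zero_of_extForm_row (Y : (Fin n → F) ≃ₗ[F] (Fin 3 → K)) {v : Fin n → E}
    (h : ∀ (θ : K →ₗ[F] F) (i : Fin 3), extForm (toExt E (θ.comp (row Y i))) v = 0) : v = 0 := by
  funext m
  let T : Fin 3 → K →ₗ[F] F := fun i =>
    (LinearMap.proj m).comp (Y.symm.toLinearMap.comp (LinearMap.single F (fun _ => K) i))
  have hT : ∀ w : Fin n → F, w m = ∑ i, T i (Y w i) := fun w => by
    have : Y w = ∑ i, LinearMap.single F (fun _ => K) i (Y w i) := by
      simpa using (Finset.univ_sum_single (Y w)).symm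
    conv_lhs => rw [← Y.symm_apply_apply w, this]
    simp [T]
  have h1 := extForm_eq_sum Finset.univ (fun _ => (1 : E))
    (fun i => toExt E ((T i).comp (row Y i))) (toExt E (LinearMap.proj m : (Fin n → F) →ₗ[F] F))
    (fun w => by simp [hT w]) v
  have h2 : extForm (toExt E (LinearMap.proj m : (Fin n → F) →ₗ[F] F)) v = v m := by
    simp [extForm_apply, Pi.single_apply]
  rw [← h2, h1]
  simp [h]

theorem extSubspace_self (U : Submodule F (Fin n → F)) : extSubspace F U = U := by
  have : extVec F '' (U : Set (Fin n → F)) = U := Set.image_id _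
  rw [extSubspace, this, Submodule.span_eq]

variable [Finite F]

/-- Coordinates of `PG(8, q)` with respect to the frame of the subplane of the conic. -/
noncomputable def BoseRep.frameEquiv (hK : Module.finrank F K = 3) (B : BoseRep F K)
    (C : SubConic F K) : (Fin 9 → F) ≃ₗ[F] (Fin 3 → K) :=
  (B.traceEquiv hK).symm.trans (C.frame.symm.restrictScalars F)

theorem BoseRep.frameEquiv_apply (hK : Module.finrank F K = 3) (B : BoseRep F K)
    (C : SubConic F K) (w : Fin 9 → F) :
    B.frameEquiv hK C w = C.frame.symm ((B.traceEquiv hK).symm w) := rfl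

/-- Over any extension `E`, the points of the conic variety are the pure tensors `μ ⊗ c` with `c` a
point of the conic over `E`; the vector `μ` of `K ⊗ E` is given by its values on the forms `θ`. -/
theorem mem_conicVariety_iff (hK : Module.finrank F K = 3) (B : BoseRep F K) (C : SubConic F K)
    (P : ℙ E (Fin 9 → E)) : P ∈ (B.conicVariety hK C).points E ↔
      ∃ (μ : (K →ₗ[F] F) → E) (c : Fin 3 → E), MvPolynomial.aeval c C.f = 0 ∧
        ∀ θ i, extForm (toExt E (θ.comp (row (B.frameEquiv hK C) i))) P.rep = μ θ * c i := by
  set y : (K →ₗ[F] F) → Fin 3 → E :=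
    fun θ i => extForm (toExt E (θ.comp (row (B.frameEquiv hK C) i))) P.rep with hy
  have hcoord : ∀ θ i, MvPolynomial.aeval P.rep (B.coord hK C θ i) = y θ i := fun θ i =>
    aeval_linPoly _ _
  have hf : ∀ θ, MvPolynomial.aeval P.rep (MvPolynomial.aeval (B.coord hK C θ) C.f) =
      MvPolynomial.aeval (y θ) C.f := fun θ => by
    rw [← AlgHom.comp_apply, MvPolynomial.comp_aeval]
    simp only [hcoord]
  constructor
  · intro h
    have h1 : ∀ θ θ' i j, y θ i * y θ' j = y θ j * y θ' i := fun θ θ' i j => by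
      have := h _ (.inl ⟨θ, θ', i, j, rfl⟩)
      simpa [hcoord, sub_eq_zero] using this
    have h2 : ∀ θ, MvPolynomial.aeval (y θ) C.f = 0 := fun θ => by
      rw [← hf]
      exact h _ (.inr ⟨θ, rfl⟩)
    have h3 : ∃ θ i, y θ i ≠ 0 := by
      by_contra! hcon
      exact P.rep_nonzero (eq_zero_of_extForm_row (B.frameEquiv hK C) hcon)
    obtain ⟨θ₀, i₀, h0⟩ := h3
    refine ⟨fun θ => y θ i₀ / y θ₀ i₀, y θ₀, h2 θ₀, fun θ i => ?_⟩
    change y θ i = _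
    field_simp
    exact h1 θ θ₀ i i₀
  · rintro ⟨μ, c, hc, h⟩ p (⟨θ, θ', i, j, rfl⟩ | ⟨θ, rfl⟩)
    · have h' : ∀ θ i, y θ i = μ θ * c i := h
      simp only [map_sub, map_mul, hcoord, h']
      ring
    · rw [hf]
      have : y θ = μ θ • c := funext fun i => h θ i
      rw [this, aeval_smul_of_isHomogeneous C.homogeneous, hc, mul_zero]

theorem bruckBoseVariety_points (hK : Module.finrank F K = 3) (B : BoseRep F K)
    (Sg : Submodule F (Fin 9 → F)) (C : SubConic F K) (E : Type*) [Field E] [Algebra F E] :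
    (B.bruckBoseVariety hK Sg C).points E =
      (B.conicVariety hK C).points E ∩ pointsOf (extSubspace E Sg) := by
  rw [BoseRep.bruckBoseVariety, inter_points, linearVariety_points]

theorem bruckBoseVariety_points_self (hK : Module.finrank F K = 3) (B : BoseRep F K)
    (Sg : Submodule F (Fin 9 → F)) (C : SubConic F K) :
    (B.bruckBoseVariety hK Sg C).points F = B.bruckBose Sg C := by
  have : FiniteDimensional F K := Module.finite_of_finrank_eq_succ hK
  rw [bruckBoseVariety_points, extSubspace_self]
  ext P
  simp only [Set.mem_inter_iff, BoseRep.bruckBose, Set.mem_ofPred_eq]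
  rw [and_comm]
  refine and_congr_right fun _ => ?_
  rw [mem_conicVariety_iff]
  have hself : ∀ g : (Fin 9 → F) →ₗ[F] F, extForm (toExt F g) P.rep = g P.rep := fun g =>
    extForm_extVec (toExt F g) P.rep
  have hY0 : B.frameEquiv hK C P.rep ≠ 0 :=
    (LinearEquiv.map_ne_zero_iff _).2 P.rep_nonzero
  simp only [hself, LinearMap.comp_apply, row_apply]
  constructor
  · rintro ⟨μ, c, hc, h⟩
    let b := Module.finBasis F K
    set κ : K := ∑ i, algebraMap F K (μ (b.coord i)) * b i with hκ
    have hy : B.frameEquiv hK C P.rep = κ • extVec K c := by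
      funext i
      rw [← b.sum_repr (B.frameEquiv hK C P.rep i)]
      simp only [hκ, Pi.smul_apply, smul_eq_mul, extVec, Finset.sum_mul]
      refine Finset.sum_congr rfl fun j _ => ?_
      rw [← b.coord_apply, h, Algebra.smul_def, map_mul]
      ring
    have hc0 : extVec K c ≠ 0 := by
      intro h0
      rw [h0, smul_zero] at hy
      exact hY0 hy
    have hc0' : C.frame (extVec K c) ≠ 0 := (LinearEquiv.map_ne_zero_iff _).2 hc0
    refine ⟨Projectivization.mk K _ hc0', ⟨c, ?_, hc, Projectivization.submodule_mk _ _⟩, ?_⟩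
    · rintro rfl
      exact hc0 (by funext i; simp [extVec])
    · rw [mem_pointsOf, B.mem_rep_iff hK, Projectivization.submodule_mk,
        Submodule.mem_span_singleton]
      refine ⟨κ, ?_⟩
      rw [← map_smul, ← hy, B.frameEquiv_apply, LinearEquiv.apply_symm_apply]
  · rintro ⟨X, ⟨x, -, hfx, hX⟩, hP⟩
    rw [mem_pointsOf, B.mem_rep_iff hK, hX, Submodule.mem_span_singleton] at hP
    obtain ⟨κ, hκ⟩ := hP
    have hy : B.frameEquiv hK C P.rep = κ • extVec K x := by
      rw [B.frameEquiv_apply, ← hκ, map_smul, LinearEquiv.symm_apply_apply]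
    refine ⟨fun θ => θ κ, x, hfx, fun θ i => ?_⟩
    rw [hy, Pi.smul_apply, smul_eq_mul, extVec, mul_comm, ← Algebra.smul_def, map_smul,
      smul_eq_mul, mul_comm]

end Rows

/-! ### Frobenius and the three conjugate coordinate systems over `L` -/

section Frobenius

variable (F : Type*) [Field F] [Finite F]

/-- The Frobenius map `x ↦ x^q`, `q = |F|`. -/
noncomputable def frob (L : Type*) [Field L] [Algebra F L] : L →ₐ[F] L :=
  letI := Fintype.ofFinite F
  FiniteField.frobeniusAlgHom F L

theorem frob_pow_apply {L : Type*} [Field L] [Algebra F L] (j : ℕ) (x : L) :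
    (frob F L ^ j) x = x ^ Nat.card F ^ j := by
  let _ := Fintype.ofFinite F
  rw [AlgHom.coe_pow, frob, FiniteField.coe_frobeniusAlgHom, pow_iterate,
    Nat.card_eq_fintype_card]

/-- The fixed field of the Frobenius map is `F`, since this map generates the Galois group. -/
theorem mem_range_of_frob_eq {L : Type*} [Field L] [Algebra F L] [Finite L] {x : L}
    (hx : frob F L x = x) : ∃ a : F, algebraMap F L a = x := by
  let _ := Fintype.ofFinite F
  have h : ∀ n : ℕ, (frob F L ^ n) x = x := fun n => by
    induction n with
    | zero => rfl
    | succ n ih => rw [pow_succ, AlgHom.mul_apply, hx, ih]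
  refine (IsGalois.mem_range_algebraMap_iff_fixed (F := F) (E := L) x).2 fun g => ?_
  obtain ⟨n, hn⟩ := (FiniteField.bijective_frobeniusAlgHom_pow F L).2 (g : L →ₐ[F] L)
  have := DFunLike.congr_fun hn x
  exact this.symm.trans (h n)

theorem frob_pow_finrank_eq {K L : Type*} [Field K] [Field L] [Algebra F K] [Algebra F L]
    [Algebra K L] [Module.Finite F K] (x : L) :
    (frob F L ^ Module.finrank F K) x = @frob K _ (Module.finite_of_finite F) L _ _ x := by
  have : Finite K := Module.finite_of_finite F
  rw [← pow_one (frob K L), frob_pow_apply, frob_pow_apply, pow_one]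
  let _ := Fintype.ofFinite F
  let _ := Fintype.ofFinite K
  rw [Nat.card_eq_fintype_card, Nat.card_eq_fintype_card, ← Module.card_eq_pow_finrank]

variable {F} {K L : Type*} [Field K] [Field L] [Algebra F K] [Algebra F L] [Algebra K L]
  [IsScalarTower F K L]

variable (F L) in
/-- The embedding `x ↦ x^(q^j)` of `K` in `L`. -/
noncomputable def emb (j : ℕ) : K →ₐ[F] L :=
  (frob F L ^ j).comp (IsScalarTower.toAlgHom F K L)

theorem emb_apply (j : ℕ) (x : K) : emb F L j x = (frob F L ^ j) (algebraMap K L x) := rfl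

/-- An `F`-linear form on `K` has the shape `x ↦ Tr(d x)`, a combination of the embeddings. -/
theorem exists_coeff_emb [Finite L] (hK : Module.finrank F K = 3) (θ : K →ₗ[F] F) :
    ∃ a : Fin 3 → L, ∀ x, algebraMap F L (θ x) = ∑ j : Fin 3, a j * emb F L j x := by
  have : FiniteDimensional F K := Module.finite_of_finrank_eq_succ hK
  have : Finite K := Module.finite_of_finite F
  obtain ⟨d, hd⟩ := (LinearMap.BilinForm.toDual (Algebra.traceForm F K)
    (traceForm_nondegenerate F K)).surjective θ
  refine ⟨fun j => emb F L j d, fun x => ?_⟩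
  have h1 : θ x = Algebra.trace F K (d * x) := by
    rw [← hd]; rfl
  rw [h1, IsScalarTower.algebraMap_apply F K L, FiniteField.algebraMap_trace_eq_sum_pow, hK,
    map_sum, Finset.sum_range]
  refine Finset.sum_congr rfl fun j _ => ?_
  rw [← map_mul, emb_apply, frob_pow_apply, map_pow]

section Psi

variable {n : ℕ}

/-- The extension to `L^n` of the `j`-th conjugate of an `F`-linear map `F^n → K`. -/
noncomputable def conjForm (j : ℕ) (g : (Fin n → F) →ₗ[F] K) : (Fin n → L) →ₗ[L] L :=
  extForm ((emb F L j).toLinearMap.comp g)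

theorem conjForm_extVec (j : ℕ) (g : (Fin n → F) →ₗ[F] K) (x : Fin n → F) :
    conjForm j g (extVec L x) = emb F L j (g x) := extForm_extVec _ _

theorem conjForm_eq_sum {ι : Type*} (s : Finset ι) (a : ι → K) (g : ι → (Fin n → F) →ₗ[F] K)
    (g' : (Fin n → F) →ₗ[F] K) (h : ∀ x, g' x = ∑ i ∈ s, a i * g i x) (j : ℕ) (v : Fin n → L) :
    conjForm j g' v = ∑ i ∈ s, emb F L j (a i) * conjForm j (g i) v :=
  extForm_eq_sum s _ _ _ (fun x => by simp [h]) v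

theorem extForm_comp_eq_sum_conjForm {θ : K →ₗ[F] F} {a : Fin 3 → L}
    (h : ∀ x, algebraMap F L (θ x) = ∑ j : Fin 3, a j * emb F L j x)
    (g : (Fin n → F) →ₗ[F] K) (v : Fin n → L) :
    extForm (toExt L (θ.comp g)) v = ∑ j : Fin 3, a j * conjForm j g v :=
  extForm_eq_sum _ _ _ _ (fun x => h (g x)) v

/-- The conjugates of `g`, in terms of the coordinates of `g` in a basis of `K` over `F`. -/
theorem conjForm_eq_sum_extForm {ι : Type*} [Fintype ι] (b : Module.Basis ι F K) (j : ℕ)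
    (g : (Fin n → F) →ₗ[F] K) (v : Fin n → L) :
    conjForm j g v = ∑ i, emb F L j (b i) * extForm (toExt L ((b.coord i).comp g)) v := by
  refine extForm_eq_sum _ _ _ _ (fun x => ?_) v
  simp only [LinearMap.comp_apply, AlgHom.toLinearMap_apply, toExt_apply]
  conv_lhs => rw [← b.sum_repr (g x)]
  rw [map_sum]
  refine Finset.sum_congr rfl fun i _ => ?_
  rw [map_smul, Algebra.smul_def, mul_comm, b.coord_apply]

/-- The extension of the subspace on which `g` takes values in `F` is the one on which the conjugates
of `g` agree. -/
theorem mem_extSubspace_of_conjForm_eq [Finite L] (hK : Module.finrank F K = 3)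
    {g : (Fin n → F) →ₗ[F] K} (hg : Function.Surjective g) {U : Submodule F (Fin n → F)}
    (hU : ∀ w, w ∈ U ↔ ∃ a : F, algebraMap F K a = g w) (v : Fin n → L) :
    v ∈ extSubspace L U ↔ ∃ z, ∀ j : Fin 3, conjForm j g v = z := by
  constructor
  · intro hv
    refine ⟨conjForm 0 g v, fun j => ?_⟩
    have : extSubspace L U ≤ LinearMap.eqLocus (conjForm (L := L) j g) (conjForm 0 g) := by
      rw [extSubspace, Submodule.span_le]
      rintro _ ⟨x, hx, rfl⟩
      obtain ⟨a, ha⟩ := (hU x).1 hx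
      change conjForm j g (extVec L x) = conjForm 0 g (extVec L x)
      rw [conjForm_extVec, conjForm_extVec, ← ha, AlgHom.commutes, AlgHom.commutes]
    exact this hv
  · rintro ⟨z, hz⟩
    rw [mem_extSubspace_iff]
    intro u hu
    obtain ⟨s, hs⟩ := g.exists_rightInverse_of_surjective (LinearMap.range_eq_top.2 hg)
    have hs' : ∀ x, g (s x) = x := fun x => LinearMap.congr_fun hs x
    have hug : u = (u.comp s).comp g := LinearMap.ext fun w => by
      have := hu (w - s (g w)) ((hU _).2 ⟨0, by simp [hs']⟩)
      simpa [sub_eq_zero] using this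
    have h1 : (u.comp s) 1 = 0 := hu _ ((hU _).2 ⟨1, by simp [hs']⟩)
    obtain ⟨a, ha⟩ := exists_coeff_emb (L := L) hK (u.comp s)
    have h2 : ∑ j, a j = 0 := by simpa [h1] using (ha 1).symm
    rw [hug, extForm_comp_eq_sum_conjForm ha]
    simp [hz, ← Finset.sum_mul, h2]

theorem mem_extSubspace_of_conjForm_eq_zero [Finite L] (hK : Module.finrank F K = 3)
    {g : (Fin n → F) →ₗ[F] K} (hg : Function.Surjective g) {U : Submodule F (Fin n → F)}
    (hU : ∀ w, w ∈ U ↔ g w = 0) {v : Fin n → L} (hv : ∀ j : Fin 3, conjForm j g v = 0) :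
    v ∈ extSubspace L U := by
  rw [mem_extSubspace_iff]
  intro u hu
  obtain ⟨s, hs⟩ := g.exists_rightInverse_of_surjective (LinearMap.range_eq_top.2 hg)
  have hs' : ∀ x, g (s x) = x := fun x => LinearMap.congr_fun hs x
  have hug : u = (u.comp s).comp g := LinearMap.ext fun w => by
    have := hu (w - s (g w)) ((hU _).2 (by simp [hs']))
    simpa [sub_eq_zero] using this
  obtain ⟨a, ha⟩ := exists_coeff_emb (L := L) hK (u.comp s)
  rw [hug, extForm_comp_eq_sum_conjForm ha]
  simp [hv]

/-- Coordinates on `L ⊗ K^3`, split into three conjugate copies of `L^3`. -/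
noncomputable def psi [Finite L] (hK : Module.finrank F K = 3)
    (Y : (Fin 9 → F) ≃ₗ[F] (Fin 3 → K)) : (Fin 9 → L) ≃ₗ[L] (Fin 3 → Fin 3 → L) :=
  LinearEquiv.ofInjectiveOfFinrankEq
    (LinearMap.pi fun j : Fin 3 => LinearMap.pi fun i => conjForm j (row Y i))
    (by
      rw [← LinearMap.ker_eq_bot, LinearMap.ker_eq_bot']
      intro v hv
      refine eq_zero_of_extForm_row Y fun θ i => ?_
      obtain ⟨a, ha⟩ := exists_coeff_emb (L := L) hK θ
      rw [extForm_comp_eq_sum_conjForm ha]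
      refine Finset.sum_eq_zero fun j _ => ?_
      have : conjForm j (row Y i) v = 0 := congrFun (congrFun hv j) i
      rw [this, mul_zero])
    (by simp [Module.finrank_pi_fintype])

theorem psi_apply [Finite L] (hK : Module.finrank F K = 3) (Y : (Fin 9 → F) ≃ₗ[F] (Fin 3 → K))
    (v : Fin 9 → L) (j i : Fin 3) : psi hK Y v j i = conjForm j (row Y i) v := rfl

theorem psi_extVec [Finite L] (hK : Module.finrank F K = 3) (Y : (Fin 9 → F) ≃ₗ[F] (Fin 3 → K))
    (x : Fin 9 → F) (j i : Fin 3) : psi (L := L) hK Y (extVec L x) j i = emb F L j (Y x i) :=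
  conjForm_extVec _ _ _

theorem mem_conicVariety_iff_psi [Finite L] (hK : Module.finrank F K = 3) (B : BoseRep F K)
    (C : SubConic F K) (P : ℙ L (Fin 9 → L)) : P ∈ (B.conicVariety hK C).points L ↔
      ∃ l c : Fin 3 → L, MvPolynomial.aeval c C.f = 0 ∧
        ∀ j i, psi hK (B.frameEquiv hK C) P.rep j i = l j * c i := by
  have : FiniteDimensional F K := Module.finite_of_finrank_eq_succ hK
  rw [mem_conicVariety_iff]
  simp only [psi_apply]
  constructor
  · rintro ⟨μ, c, hc, h⟩
    let b := Module.finBasis F K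
    refine ⟨fun j => ∑ i, emb F L j (b i) * μ (b.coord i), c, hc, fun j i => ?_⟩
    rw [conjForm_eq_sum_extForm b]
    simp only [h, Finset.sum_mul, mul_assoc]
  · rintro ⟨l, c, hc, h⟩
    choose a ha using fun θ : K →ₗ[F] F => exists_coeff_emb (L := L) hK θ
    refine ⟨fun θ => ∑ j, a θ j * l j, c, hc, fun θ i => ?_⟩
    rw [extForm_comp_eq_sum_conjForm (ha θ)]
    simp only [h, Finset.sum_mul, mul_assoc]

end Psi

end Frobenius

/-! ### Normal form of a conic over a finite field -/

section Conic

variable {F : Type*} [Field F]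

theorem exists_coeff_of_isHomogeneous_two {n : ℕ} {f : MvPolynomial (Fin n) F}
    (hf : f.IsHomogeneous 2) : ∃ a : Fin n → Fin n → F,
      f = ∑ i, ∑ j, MvPolynomial.C (a i j) * (MvPolynomial.X i * MvPolynomial.X j) := by
  have hlin : ∀ p ∈ MvPolynomial.homogeneousSubmodule (Fin n) F 1,
      ∃ a : Fin n → F, p = ∑ i, MvPolynomial.C (a i) * MvPolynomial.X i := by
    intro p hp
    rw [MvPolynomial.homogeneousSubmodule_one_eq_span_X, Submodule.mem_span_range_iff_exists_fun] at hp
    obtain ⟨a, rfl⟩ := hp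
    exact ⟨a, by simp [MvPolynomial.smul_eq_C_mul]⟩
  have hf' : f ∈ MvPolynomial.homogeneousSubmodule (Fin n) F 1 ^ 2 := by
    rw [MvPolynomial.homogeneousSubmodule_one_pow]; exact hf
  rw [sq] at hf'
  clear hf
  induction hf' using Submodule.mul_induction_on' with
  | mem_mul_mem p hp r hr =>
    obtain ⟨a, rfl⟩ := hlin p hp
    obtain ⟨b, rfl⟩ := hlin r hr
    refine ⟨fun i j => a i * b j, ?_⟩
    rw [Finset.sum_mul_sum]
    refine Finset.sum_congr rfl fun i _ => Finset.sum_congr rfl fun j _ => ?_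
    rw [map_mul]; ring
  | add p _ r _ hp hr =>
    obtain ⟨a, rfl⟩ := hp
    obtain ⟨b, rfl⟩ := hr
    exact ⟨fun i j => a i j + b i j, by simp [add_mul, Finset.sum_add_distrib]⟩

/-- The quadratic form with coefficient matrix `a`. -/
def quad {E : Type*} [Field E] [Algebra F E] (a : Fin 3 → Fin 3 → F) (x : Fin 3 → E) : E :=
  ∑ i, ∑ j, algebraMap F E (a i j) * (x i * x j)

/-- The polar form of `quad a`. -/
def polar (a : Fin 3 → Fin 3 → F) : (Fin 3 → F) →ₗ[F] (Fin 3 → F) →ₗ[F] F :=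
  Matrix.toLinearMap₂' F (Matrix.of a + (Matrix.of a).transpose)

theorem polar_apply (a : Fin 3 → Fin 3 → F) (x y : Fin 3 → F) :
    polar a x y = ∑ i, ∑ j, (a i j + a j i) * (x i * y j) := by
  simp only [polar, Matrix.toLinearMap₂'_apply, Matrix.add_apply, Matrix.of_apply,
    Matrix.transpose_apply, smul_eq_mul]
  exact Finset.sum_congr rfl fun _ _ => Finset.sum_congr rfl fun _ _ => by ring

theorem quad_sum {E : Type*} [Field E] [Algebra F E] (a : Fin 3 → Fin 3 → F)
    (b : Fin 3 → Fin 3 → F) (z : Fin 3 → E) :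
    quad a (∑ m, z m • extVec E (b m)) =
      algebraMap F E (quad a (b 0)) * z 0 ^ 2 + algebraMap F E (quad a (b 1)) * z 1 ^ 2 +
      algebraMap F E (quad a (b 2)) * z 2 ^ 2 + algebraMap F E (polar a (b 0) (b 1)) * (z 0 * z 1) +
      algebraMap F E (polar a (b 0) (b 2)) * (z 0 * z 2) +
      algebraMap F E (polar a (b 1) (b 2)) * (z 1 * z 2) := by
  simp only [quad, polar_apply, Fin.sum_univ_three, Pi.add_apply, Pi.smul_apply, smul_eq_mul,
    extVec, map_add, map_mul, Algebra.algebraMap_self, RingHom.id_apply]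
  ring

theorem quad_add (a : Fin 3 → Fin 3 → F) (x y : Fin 3 → F) :
    quad a (x + y) = quad a x + quad a y + polar a x y := by
  simp only [quad, polar_apply, Fin.sum_univ_three, Pi.add_apply, Algebra.algebraMap_self,
    RingHom.id_apply]
  ring

theorem quad_smul (a : Fin 3 → Fin 3 → F) (c : F) (x : Fin 3 → F) :
    quad a (c • x) = c ^ 2 * quad a x := by
  simp only [quad, Fin.sum_univ_three, Pi.smul_apply, smul_eq_mul, Algebra.algebraMap_self,
    RingHom.id_apply]
  ring

theorem polar_comm (a : Fin 3 → Fin 3 → F) (x y : Fin 3 → F) : polar a x y = polar a y x := by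
  simp only [polar_apply, Fin.sum_univ_three]
  ring

theorem polar_self (a : Fin 3 → Fin 3 → F) (x : Fin 3 → F) : polar a x x = 2 * quad a x := by
  simp only [quad, polar_apply, Fin.sum_univ_three, Algebra.algebraMap_self, RingHom.id_apply]
  ring

/-- A zero `P` of a nonsingular ternary quadratic form lies in a hyperbolic pair; together with a
vector orthogonal to the pair it gives a basis in which the form is a multiple of
`z_0 z_2 - z_1^2`. -/
theorem exists_basis_of_quad_eq_zero {a : Fin 3 → Fin 3 → F}
    (hns : ∀ x, x ≠ 0 → quad a x = 0 → ∃ y, polar a x y ≠ 0) {P : Fin 3 → F} (hP : P ≠ 0)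
    (hP0 : quad a P = 0) :
    ∃ (b : Module.Basis (Fin 3) F (Fin 3 → F)) (κ : F), κ ≠ 0 ∧ b 2 = P ∧ quad a (b 0) = 0 ∧
      ∀ (E : Type*) [Field E] [Algebra F E] (z : Fin 3 → E),
        quad a (∑ m, z m • extVec E (b m)) = algebraMap F E κ * (z 0 * z 2 - z 1 ^ 2) := by
  obtain ⟨y, hy⟩ := hns P hP hP0
  have hPP : polar a P P = 0 := by rw [polar_self, hP0, mul_zero]
  obtain ⟨R₀, hR₀⟩ : ∃ R₀, polar a P R₀ = 1 := ⟨(polar a P y)⁻¹ • y, by simp [hy]⟩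
  set R := R₀ + (-quad a R₀) • P with hR
  have hPR : polar a P R = 1 := by simp [hR, hR₀, hPP]
  have hRq : quad a R = 0 := by
    rw [hR, quad_add, quad_smul, hP0, map_smul, polar_comm a R₀ P, hR₀]
    simp
  have hRR : polar a R R = 0 := by rw [polar_self, hRq, mul_zero]
  have hRP : polar a R P = 1 := by rw [polar_comm, hPR]
  obtain ⟨w, hw, hw0⟩ : ∃ w ∈ LinearMap.ker ((polar a P).prod (polar a R)), w ≠ 0 :=
    Submodule.exists_mem_ne_zero_of_ne_bot (LinearMap.ker_ne_bot_of_finrank_lt (by simp))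
  have hPw : polar a P w = 0 := congrArg Prod.fst hw
  have hRw : polar a R w = 0 := congrArg Prod.snd hw
  have hwP : polar a w P = 0 := by rw [polar_comm, hPw]
  have hwR : polar a w R = 0 := by rw [polar_comm, hRw]
  have hli : ∀ κ : F, κ ≠ 0 → LinearIndependent F ![κ • R, w, P] := fun κ hκ => by
    rw [Fintype.linearIndependent_iff]
    intro g hg
    simp only [Fin.sum_univ_three, Matrix.cons_val_zero, Matrix.cons_val_one,
      Matrix.cons_val] at hg
    have h0 : g 0 = 0 := by
      have := congrArg (polar a P) hg
      simpa [hPR, hPw, hPP, hκ] using this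
    have h2 : g 2 = 0 := by
      have := congrArg (polar a R) hg
      simpa [hRR, hRw, hRP] using this
    have h1 : g 1 = 0 := by
      rw [h0, h2] at hg
      simpa [hw0] using hg
    intro i
    fin_cases i <;> assumption
  have hbasis : ∀ κ : F, κ ≠ 0 → ∃ b : Module.Basis (Fin 3) F (Fin 3 → F),
      b 0 = κ • R ∧ b 1 = w ∧ b 2 = P := fun κ hκ =>
    ⟨basisOfLinearIndependentOfCardEqFinrank (hli κ hκ) (by simp), by simp, by simp, by simp⟩
  have hwq : quad a w ≠ 0 := by
    intro hq
    obtain ⟨y, hy⟩ := hns w hw0 hq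
    obtain ⟨b, hb0, hb1, hb2⟩ := hbasis 1 one_ne_zero
    refine hy ?_
    rw [← b.sum_repr y, map_sum, Fin.sum_univ_three]
    simp only [map_smul, hb0, hb1, hb2, hwP, hwR, polar_self, hq, smul_zero, mul_zero, add_zero]
  obtain ⟨b, hb0, hb1, hb2⟩ := hbasis (-quad a w) (neg_ne_zero.2 hwq)
  refine ⟨b, -quad a w, neg_ne_zero.2 hwq, hb2, by rw [hb0, quad_smul, hRq, mul_zero],
    fun E _ _ z => ?_⟩
  rw [quad_sum, hb0, hb1, hb2]
  simp only [quad_smul, hRq, hP0, map_smul, LinearMap.smul_apply, hRw, hRP, hwP, smul_eq_mul,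
    mul_zero, mul_one, map_zero, zero_mul, map_neg]
  ring

/-- A nonsingular conic over a finite field has, off any line over an extension field, a rational
point which is the last vector of a basis in which the conic is `z_0 z_2 = z_1^2`. -/
theorem exists_conic_basis [Finite F] {K : Type*} [Field K] [Algebra F K]
    {f : MvPolynomial (Fin 3) F} (hf : f.IsHomogeneous 2)
    (hns : ∀ x : Fin 3 → F, x ≠ 0 → MvPolynomial.eval x f = 0 →
      ∃ i, MvPolynomial.eval x (MvPolynomial.pderiv i f) ≠ 0)
    {h : (Fin 3 → F) →ₗ[F] K} (hh : h ≠ 0) :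
    ∃ (b : Module.Basis (Fin 3) F (Fin 3 → F)) (κ : F), κ ≠ 0 ∧ h (b 2) ≠ 0 ∧
      ∀ (E : Type*) [Field E] [Algebra F E] (z : Fin 3 → E),
        MvPolynomial.aeval (∑ m, z m • extVec E (b m)) f =
          algebraMap F E κ * (z 0 * z 2 - z 1 ^ 2) := by
  classical
  have _ := Fintype.ofFinite F
  -- a rational point of the conic, by the Chevalley–Warning theorem
  obtain ⟨P, hP, hP0⟩ : ∃ P : Fin 3 → F, P ≠ 0 ∧ MvPolynomial.eval P f = 0 := by
    obtain ⟨p, hp⟩ := CharP.exists F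
    have hdvd := char_dvd_card_solutions p (f := f) (by
      have := hf.totalDegree_le
      simp only [Fintype.card_fin]
      omega)
    have hz : MvPolynomial.eval (0 : Fin 3 → F) f = 0 := by
      have := aeval_smul_of_isHomogeneous (E := F) hf 0 0
      simpa [MvPolynomial.aeval_eq_eval] using this
    have h1 : 1 < Fintype.card {x // MvPolynomial.eval x f = 0} :=
      (CharP.char_is_prime F p).one_lt.trans_le
        (Nat.le_of_dvd (Fintype.card_pos_iff.2 ⟨⟨0, hz⟩⟩) hdvd)
    have : Nontrivial {x // MvPolynomial.eval x f = 0} := Fintype.one_lt_card_iff_nontrivial.1 h1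
    obtain ⟨x, hx⟩ := exists_ne (⟨0, hz⟩ : {x // MvPolynomial.eval x f = 0})
    exact ⟨x, fun h0 => hx (Subtype.ext h0), x.2⟩
  obtain ⟨a, rfl⟩ := exists_coeff_of_isHomogeneous_two hf
  have hq : ∀ (E : Type _) [Field E] [Algebra F E] (x : Fin 3 → E), MvPolynomial.aeval x
      (∑ i, ∑ j, MvPolynomial.C (a i j) * (MvPolynomial.X i * MvPolynomial.X j)) = quad a x :=
    fun E _ _ x => by simp [quad]
  have hq' : ∀ x : Fin 3 → F, MvPolynomial.eval x
      (∑ i, ∑ j, MvPolynomial.C (a i j) * (MvPolynomial.X i * MvPolynomial.X j)) = quad a x :=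
    fun x => by simp [quad]
  have hns' : ∀ x, x ≠ 0 → quad a x = 0 → ∃ y, polar a x y ≠ 0 := by
    intro x hx hx0
    obtain ⟨i, hi⟩ := hns x hx (by rw [hq', hx0])
    refine ⟨Pi.single i 1, ?_⟩
    convert hi using 1
    rw [polar_apply]
    fin_cases i <;> simp [Fin.sum_univ_three, MvPolynomial.pderiv_X, Pi.single_apply] <;> ring
  -- it suffices to find a zero off the line `h = 0`
  suffices hs : ∃ P, quad a P = 0 ∧ h P ≠ 0 by
    obtain ⟨P, hP0, hhP⟩ := hs
    have hP : P ≠ 0 := by rintro rfl; simp at hhP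
    obtain ⟨b, κ, hκ, hb2, -, hb⟩ := exists_basis_of_quad_eq_zero hns' hP hP0
    exact ⟨b, κ, hκ, by rwa [hb2], fun E _ _ z => by rw [hq, hb]⟩
  obtain ⟨b, κ, hκ, hb2, hb0, hb⟩ := exists_basis_of_quad_eq_zero hns' hP (by rw [← hq', hP0])
  -- otherwise `h` vanishes at the zeros `b 0`, `b 2`, `b 0 + b 1 + b 2`, hence everywhere
  by_contra! hcon
  have h2 : h (b 2) = 0 := hcon _ (by rw [hb2, ← hq', hP0])
  have h0 : h (b 0) = 0 := hcon _ hb0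
  have h1 : h (b 1) = 0 := by
    have := hcon (b 0 + b 1 + b 2) (by
      have := hb F 1
      have h3 : ∑ m, (1 : Fin 3 → F) m • extVec F (b m) = b 0 + b 1 + b 2 := by
        simp only [Fin.sum_univ_three, Pi.one_apply, one_smul]; rfl
      rw [h3] at this
      simpa using this)
    simpa [h0, h2] using this
  refine hh (b.ext fun i => ?_)
  fin_cases i <;> simpa

end Conic

/-! ### The least multiple over `F` of a quadratic polynomial over `K` -/

section Cofactor

open Polynomial

theorem exists_roots_of_natDegree_two {K L : Type*} [Field K] [Field L] [Algebra K L] [Finite L]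
    (hL : Module.finrank K L = 2) {H : K[X]} (hH : H.Monic) (hd : H.natDegree = 2) :
    ∃ r r' : L, H.map (algebraMap K L) = (X - C r) * (X - C r') := by
  have hroot : ∃ r : L, (H.map (algebraMap K L)).IsRoot r := by
    by_cases hirr : Irreducible H
    · have : Fact (Irreducible H) := ⟨hirr⟩
      have hfin : Module.finrank K (AdjoinRoot H) = 2 := by
        rw [(AdjoinRoot.powerBasis hirr.ne_zero).finrank, AdjoinRoot.powerBasis_dim, hd]
      obtain ⟨g⟩ := FiniteField.nonempty_algHom_of_finrank_dvd (F := K) (K := AdjoinRoot H) (L := L)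
        (by rw [hfin, hL])
      refine ⟨g (AdjoinRoot.root H), ?_⟩
      rw [IsRoot.def, eval_map_algebraMap, aeval_algHom_apply, AdjoinRoot.aeval_eq,
        AdjoinRoot.mk_self, map_zero]
    · rw [hH.irreducible_iff_roots_eq_zero_of_degree_le_three (by omega) (by omega)] at hirr
      obtain ⟨r, hr⟩ := Multiset.exists_mem_of_ne_zero hirr
      exact ⟨algebraMap K L r, (isRoot_of_mem_roots hr).map⟩
  obtain ⟨r, hr⟩ := hroot
  obtain ⟨p, hp⟩ := dvd_iff_isRoot.2 hr
  have hm : p.Monic := (monic_X_sub_C r).of_mul_monic_left (hp ▸ hH.map _)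
  have hdeg : p.natDegree = 1 := by
    have := congrArg natDegree hp
    rw [(monic_X_sub_C r).natDegree_mul hm, natDegree_map, hd, natDegree_X_sub_C] at this
    omega
  refine ⟨r, -p.coeff 0, ?_⟩
  rw [hp, map_neg, sub_neg_eq_add, ← hm.eq_X_add_C hdeg]

theorem roots_eq_of_mul_eq {L : Type*} [Field L] {a b c d : L}
    (h : (X - C a) * (X - C b) = (X - C c) * (X - C d)) : a = c ∧ b = d ∨ a = d ∧ b = c := by
  have h1 := congrArg (eval a) h
  have h0 := congrArg (eval 0) h
  have h2 := congrArg (eval 1) h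
  simp only [eval_mul, eval_sub, eval_X, eval_C, sub_self, zero_mul] at h0 h1 h2
  rcases mul_eq_zero.1 h1.symm with h3 | h3
  · exact .inl ⟨sub_eq_zero.1 h3, by linear_combination h0 - h2 - h3⟩
  · exact .inr ⟨sub_eq_zero.1 h3, by linear_combination h0 - h2 - h3⟩

theorem frob_pow_three_algebraMap {F K L : Type*} [Field F] [Finite F] [Field K] [Field L]
    [Algebra F K] [Algebra F L] [Algebra K L] (hK : Module.finrank F K = 3) (x : K) :
    (frob F L ^ 3) (algebraMap K L x) = algebraMap K L x := by
  have : FiniteDimensional F K := Module.finite_of_finrank_eq_succ hK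
  rw [← hK, frob_pow_finrank_eq, AlgHom.commutes]

theorem exists_algebraMap_of_frob_pow_three {F K L : Type*} [Field F] [Finite F] [Field K] [Field L]
    [Algebra F K] [Algebra F L] [Algebra K L] [Finite L] (hK : Module.finrank F K = 3) {x : L}
    (hx : (frob F L ^ 3) x = x) : ∃ k : K, algebraMap K L k = x := by
  have : FiniteDimensional F K := Module.finite_of_finrank_eq_succ hK
  have : Finite K := Module.finite_of_finite F
  rw [← hK, frob_pow_finrank_eq] at hx
  exact mem_range_of_frob_eq K hx

variable {F K L : Type*} [Field F] [Finite F] [Field K] [Field L]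
  [Algebra F K] [Algebra F L] [Algebra K L] [IsScalarTower F K L]

variable (F L) in
/-- The image of a polynomial over `K` under the embedding `x ↦ x^(q^j)` of `K` in `L`. -/
noncomputable def conjPoly (j : ℕ) (p : K[X]) : L[X] :=
  p.map (emb F L j : K →ₐ[F] L).toRingHom

theorem conjPoly_mul (j : ℕ) (p r : K[X]) :
    conjPoly F L j (p * r) = conjPoly F L j p * conjPoly F L j r := Polynomial.map_mul _

theorem conjPoly_succ (j : ℕ) (p : K[X]) :
    conjPoly F L (j + 1) p = (conjPoly F L j p).map (frob F L).toRingHom := by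
  rw [conjPoly, conjPoly, Polynomial.map_map]
  congr 1
  ext x
  simp [emb_apply, pow_succ']

theorem conjPoly_zero (p : K[X]) : conjPoly F L 0 p = p.map (algebraMap K L) := rfl

theorem conjPoly_eq_of_one {p : K[X]} (h : conjPoly F L 1 p = conjPoly F L 0 p) (j : ℕ) :
    conjPoly F L j p = conjPoly F L 0 p := by
  induction j with
  | zero => rfl
  | succ j ih => rw [conjPoly_succ, ih, ← conjPoly_succ, h]

theorem conjPoly_three (hK : Module.finrank F K = 3) (p : K[X]) :
    conjPoly F L 3 p = conjPoly F L 0 p := by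
  rw [conjPoly, conjPoly]
  congr 1
  ext x
  simpa [emb_apply] using frob_pow_three_algebraMap hK x

theorem emb_frob (j : ℕ) (x : K) : emb F L j (frob F K x) = emb F L (j + 1) x := by
  rw [emb_apply, emb_apply, pow_succ, AlgHom.mul_apply]
  congr 1
  rw [← pow_one (frob F K), frob_pow_apply, ← pow_one (frob F L), frob_pow_apply, map_pow]

theorem conjPoly_map_frob (j : ℕ) (p : K[X]) :
    conjPoly F L j (p.map (frob F K).toRingHom) = conjPoly F L (j + 1) p := by
  rw [conjPoly, conjPoly, Polynomial.map_map]
  congr 1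
  ext x
  simpa using emb_frob j x

theorem conjPoly_eq_of_roots {H : K[X]} {r r' : L}
    (h : H.map (algebraMap K L) = (X - C r) * (X - C r')) (j : ℕ) :
    conjPoly F L j H = (X - C ((frob F L ^ j) r)) * (X - C ((frob F L ^ j) r')) := by
  induction j with
  | zero => simpa [conjPoly_zero] using h
  | succ j ih => rw [conjPoly_succ, ih]; simp [pow_succ']

theorem conjPoly_X_sub_C (j : ℕ) (k : K) : conjPoly F L j (X - C k) = X - C (emb F L j k) := by
  simp [conjPoly]

open Classical in
variable (F) in
/-- The set of those `j` for which `x` is a zero of the `j`-th conjugate of `H`. -/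
noncomputable def zeroIndices (H : K[X]) (x : L) : Finset (Fin 3) :=
  Finset.univ.filter fun j => (conjPoly F L j H).eval x = 0

theorem mem_zeroIndices {H : K[X]} {x : L} {j : Fin 3} :
    j ∈ zeroIndices F H x ↔ (conjPoly F L j H).eval x = 0 := by
  classical
  simp [zeroIndices]

theorem mem_zeroIndices_of_roots {H : K[X]} {r r' : L}
    (h : H.map (algebraMap K L) = (X - C r) * (X - C r')) {x : L} {j : Fin 3} :
    j ∈ zeroIndices F H x ↔ x = (frob F L ^ (j : ℕ)) r ∨ x = (frob F L ^ (j : ℕ)) r' := by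
  rw [mem_zeroIndices, conjPoly_eq_of_roots h]
  simp [sub_eq_zero]

/-- If two conjugates of a quadratic polynomial over `K` share a root, then its roots `r`, `r'`
are permuted by the Frobenius map, or exactly one of them is in `F` and the other in `K`, or they
are conjugate elements of `K`. -/
theorem roots_trichotomy (hK : Module.finrank F K = 3) {H : K[X]} {r r' : L}
    (h : H.map (algebraMap K L) = (X - C r) * (X - C r')) {x : L}
    (hx : 2 ≤ (zeroIndices F H x).card) :
    ∃ u u' : L, H.map (algebraMap K L) = (X - C u) * (X - C u') ∧
      ((frob F L u = u ∧ frob F L u' = u' ∨ frob F L u = u' ∧ frob F L u' = u) ∨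
      (frob F L u = u ∧ frob F L u' ≠ u' ∧ (frob F L ^ 3) u' = u') ∨
      (frob F L u = u' ∧ frob F L u ≠ u ∧ (frob F L ^ 3) u = u)) := by
  have h3 : ∀ {u u' : L}, H.map (algebraMap K L) = (X - C u) * (X - C u') →
      (frob F L ^ 3) u = u ∧ (frob F L ^ 3) u' = u' ∨
        (frob F L ^ 3) u = u' ∧ (frob F L ^ 3) u' = u := by
    intro u u' hu
    have he : (X - C ((frob F L ^ 3) u)) * (X - C ((frob F L ^ 3) u')) =
        (X - C u) * (X - C u') := by
      rw [← conjPoly_eq_of_roots hu, conjPoly_three hK, conjPoly_zero, hu]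
    exact roots_eq_of_mul_eq he
  have hinj : Function.Injective (frob F L) := (frob F L).toRingHom.injective
  -- some root is the Frobenius image of a root: a common zero of the `i`-th and `j`-th conjugates is
  -- pulled back by the `i`-th power of Frobenius, and the third power permutes the roots
  obtain ⟨u, u', hu, hroot⟩ : ∃ u u' : L, H.map (algebraMap K L) = (X - C u) * (X - C u') ∧
      (frob F L u = u ∨ frob F L u = u') := by
    have key : ∃ s, (s = r ∨ s = r') ∧ (frob F L s = r ∨ frob F L s = r') := by
      obtain ⟨i, hi, j, hj, hij⟩ := Finset.one_lt_card.1 hx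
      rw [mem_zeroIndices_of_roots h] at hi hj
      wlog hlt : i < j generalizing i j
      · exact this j hj i hi hij.symm (lt_of_le_of_ne (not_lt.1 hlt) hij.symm)
      have h3' : ∀ s, (s = r ∨ s = r') →
          ((frob F L) (frob F L (frob F L s)) = r ∨ (frob F L) (frob F L (frob F L s)) = r') := by
        have := h3 h
        simp only [pow_succ, pow_zero, one_mul, AlgHom.mul_apply] at this
        rintro s (rfl | rfl)
        · exact this.elim (fun h => .inl h.1) fun h => .inr h.1
        · exact this.elim (fun h => .inr h.2) fun h => .inl h.2
      obtain ⟨s, hs, hxs⟩ : ∃ s, (s = r ∨ s = r') ∧ x = (frob F L ^ (i : ℕ)) s :=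
        hi.elim (fun h => ⟨r, .inl rfl, h⟩) fun h => ⟨r', .inr rfl, h⟩
      obtain ⟨t, ht, hxt⟩ : ∃ t, (t = r ∨ t = r') ∧ x = (frob F L ^ (j : ℕ)) t :=
        hj.elim (fun h => ⟨r, .inl rfl, h⟩) fun h => ⟨r', .inr rfl, h⟩
      rw [hxs] at hxt
      fin_cases i <;> fin_cases j <;> simp [pow_succ] at hlt hxt
      · exact ⟨t, ht, by rwa [← hxt]⟩
      · refine ⟨s, hs, ?_⟩
        rw [hxt]
        exact h3' t ht
      · exact ⟨t, ht, by rwa [← hinj hxt]⟩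
    obtain ⟨s, rfl | rfl, hs⟩ := key
    · exact ⟨s, r', h, hs⟩
    · exact ⟨s, r, by rw [h, mul_comm], hs.symm⟩
  refine ⟨u, u', hu, ?_⟩
  by_cases huu : frob F L u = u
  · by_cases huu' : frob F L u' = u'
    · exact .inl (.inl ⟨huu, huu'⟩)
    · refine .inr (.inl ⟨huu, huu', ?_⟩)
      have hu3 : (frob F L ^ 3) u = u := by simp [pow_succ, huu]
      rcases h3 hu with h1 | h1
      · exact h1.2
      · rw [h1.2, ← hu3, h1.1]
  · have huu' : frob F L u = u' := hroot.resolve_left huu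
    rcases h3 hu with h1 | h1
    · exact .inr (.inr ⟨huu', huu, h1.1⟩)
    · refine .inl (.inr ⟨huu', ?_⟩)
      have h2 : frob F L (frob F L (frob F L u)) = frob F L u := by
        have := h1.1
        rw [← huu'] at this
        simpa [pow_succ] using this
      rw [← huu']
      exact hinj h2

theorem card_zeroIndices_of_roots [DecidableEq L] {H : K[X]} {r r' : L}
    (h : H.map (algebraMap K L) = (X - C r) * (X - C r')) (x : L) :
    (zeroIndices F H x).card = (if x = r ∨ x = r' then 1 else 0) +
      (if x = frob F L r ∨ x = frob F L r' then 1 else 0) +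
      (if x = frob F L (frob F L r) ∨ x = frob F L (frob F L r') then 1 else 0) := by
  have : zeroIndices F H x = Finset.univ.filter fun j : Fin 3 =>
      x = (frob F L ^ (j : ℕ)) r ∨ x = (frob F L ^ (j : ℕ)) r' := by
    ext j
    rw [mem_zeroIndices_of_roots h]
    simp
  rw [this, Finset.card_filter, Fin.sum_univ_three]
  simp [pow_succ]

/-- For a monic quadratic `H` over `K` there is `Q` such that `H Q` is the least common multiple of
the conjugates of `H`: it is fixed by the conjugations and the conjugates of `Q` have no common
zero. The degree of `H Q` is `6` minus the sum, over the listed common zeros `x` of two conjugates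
of `H`, of one less than the number of conjugates vanishing at `x`; a double zero of `H` that
lies in `F` is listed twice. -/
theorem exists_cofactor [Finite L] (hK : Module.finrank F K = 3) (hL : Module.finrank K L = 2)
    {H : K[X]} (hH : H.Monic) (hd : H.natDegree = 2) :
    ∃ Q : K[X], Q.Monic ∧ (∀ j, conjPoly F L j (H * Q) = conjPoly F L 0 (H * Q)) ∧
      (conjPoly F L 0 Q).Splits ∧ (∀ x : L, ∃ j : Fin 3, (conjPoly F L j Q).eval x ≠ 0) ∧
      ∃ (m : ℕ) (x : Fin m → L), (∀ i, 2 ≤ (zeroIndices F H (x i)).card) ∧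
        (∀ y : L, 2 ≤ (zeroIndices F H y).card → ∃ i, x i = y) ∧
        Q.natDegree + 2 + ∑ i, ((zeroIndices F H (x i)).card - 1) = 6 := by
  classical
  by_cases hD : ∃ x : L, 2 ≤ (zeroIndices F H x).card
  · obtain ⟨x, hx⟩ := hD
    obtain ⟨r, r', h⟩ := exists_roots_of_natDegree_two hL hH hd
    obtain ⟨u, u', hu, hA | ⟨h1, h2, h3⟩ | ⟨h1, h2, h3⟩⟩ := roots_trichotomy hK h hx
    · -- `H` is defined over `F`
      have hone : conjPoly F L 1 H = conjPoly F L 0 H := by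
        rw [conjPoly_eq_of_roots hu, conjPoly_eq_of_roots hu]
        rcases hA with ⟨ha, hb⟩ | ⟨ha, hb⟩ <;> simp [ha, hb, mul_comm]
      have hcard : ∀ y, y = u ∨ y = u' → (zeroIndices F H y).card = 3 := fun y hy => by
        rw [card_zeroIndices_of_roots hu]
        rcases hA with ⟨ha, hb⟩ | ⟨ha, hb⟩ <;> simp [ha, hb, hy, hy.symm]
      refine ⟨1, monic_one, fun j => ?_, by simp [conjPoly], fun x => ⟨0, by simp [conjPoly]⟩, 2, ![u, u'],
        fun i => ?_, fun y hy => ?_, ?_⟩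
      · rw [mul_one, conjPoly_eq_of_one hone]
      · fin_cases i <;> simp [hcard]
      · rw [card_zeroIndices_of_roots hu] at hy
        by_cases hyu : y = u
        · exact ⟨0, hyu.symm⟩
        · by_cases hyu' : y = u'
          · exact ⟨1, hyu'.symm⟩
          · exfalso
            rcases hA with ⟨ha, hb⟩ | ⟨ha, hb⟩ <;> simp [ha, hb, hyu, hyu'] at hy
      · simp [Fin.sum_univ_two, hcard]
    · -- one root is in `F`, the other one in `K`
      have hinj : Function.Injective (frob F L) := (frob F L).toRingHom.injective
      obtain ⟨k, hk⟩ := exists_algebraMap_of_frob_pow_three hK h3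
      have h3' : frob F L (frob F L (frob F L u')) = u' := by simpa [pow_succ] using h3
      have h4 : frob F L (frob F L u') ≠ u' := fun h => h2 (by rw [h] at h3'; exact h3')
      have h5 : frob F L (frob F L u') ≠ frob F L u' := fun h => h2 (hinj h)
      have hQ : ∀ j, conjPoly F L j ((X - C (frob F K k)) * (X - C (frob F K (frob F K k)))) =
          (X - C ((frob F L ^ (j + 1)) u')) * (X - C ((frob F L ^ (j + 2)) u')) := fun j => by
        rw [conjPoly_mul, conjPoly_X_sub_C, conjPoly_X_sub_C, emb_frob, emb_frob, emb_frob,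
          emb_apply, emb_apply, hk]
      refine ⟨(X - C (frob F K k)) * (X - C (frob F K (frob F K k))),
        (monic_X_sub_C _).mul (monic_X_sub_C _), fun j => conjPoly_eq_of_one ?_ j,
        by rw [hQ]; exact (Splits.X_sub_C _).mul (Splits.X_sub_C _), fun x => ?_, 1, ![u], fun i => ?_, fun y hy => ?_, ?_⟩
      · rw [conjPoly_mul _ H, conjPoly_mul _ H, hQ, hQ, conjPoly_eq_of_roots hu, conjPoly_eq_of_roots hu]
        simp only [pow_succ, pow_zero, one_mul, AlgHom.mul_apply, AlgHom.one_apply, h1, h3']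
        ring
      · by_contra! hcon
        have e0 := hcon 0
        have e1 := hcon 1
        have e2 := hcon 2
        simp only [hQ] at e0 e1 e2
        simp [pow_succ, h3', sub_eq_zero] at e0 e1 e2
        rcases e0 with rfl | rfl
        · rcases e1 with e | e
          · exact h5 e.symm
          · exact h2 e
        · rcases e2 with e | e
          · exact h4 e
          · exact h5 e
      · fin_cases i
        rw [card_zeroIndices_of_roots hu]
        simp [h1]
      · refine ⟨0, ?_⟩
        change u = y
        by_contra hne
        rw [card_zeroIndices_of_roots hu] at hy
        have hne' : y ≠ u := Ne.symm hne
        simp only [h1, hne', false_or] at hy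
        by_cases a : y = u'
        · subst a
          simp [h2.symm, h4.symm] at hy
        · by_cases b : y = frob F L u'
          · subst b
            simp [h2, h5.symm] at hy
          · simp only [a, b, if_false] at hy
            split_ifs at hy <;> omega
      · rw [(monic_X_sub_C _).natDegree_mul (monic_X_sub_C _), natDegree_X_sub_C,
          natDegree_X_sub_C]
        simp [card_zeroIndices_of_roots hu, h1]
    · -- the roots are conjugate elements of `K`
      subst h1
      have hinj : Function.Injective (frob F L) := (frob F L).toRingHom.injective
      obtain ⟨k, hk⟩ := exists_algebraMap_of_frob_pow_three hK h3
      have h3' : frob F L (frob F L (frob F L u)) = u := by simpa [pow_succ] using h3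
      have h4 : frob F L (frob F L u) ≠ u := fun h => h2 (by rw [h] at h3'; exact h3')
      have h5 : frob F L (frob F L u) ≠ frob F L u := fun h => h2 (hinj h)
      have hQ : ∀ j, conjPoly F L j (X - C (frob F K (frob F K k))) =
          X - C ((frob F L ^ (j + 2)) u) := fun j => by
        rw [conjPoly_X_sub_C, emb_frob, emb_frob, emb_apply, hk]
      have c0 : (zeroIndices F H u).card = 2 := by
        rw [card_zeroIndices_of_roots hu]
        simp [h3', h2.symm, h4.symm]
      have c1 : (zeroIndices F H (frob F L u)).card = 2 := by
        rw [card_zeroIndices_of_roots hu]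
        simp [h3', h2, h5.symm]
      have c2 : (zeroIndices F H (frob F L (frob F L u))).card = 2 := by
        rw [card_zeroIndices_of_roots hu]
        simp [h4, h5]
      refine ⟨X - C (frob F K (frob F K k)), monic_X_sub_C _, fun j => conjPoly_eq_of_one ?_ j,
        by rw [hQ]; exact Splits.X_sub_C _, fun x => ?_, 3,
        ![u, frob F L u, frob F L (frob F L u)], fun i => ?_, fun y hy => ?_, ?_⟩
      · rw [conjPoly_mul _ H, conjPoly_mul _ H, hQ, hQ, conjPoly_eq_of_roots hu, conjPoly_eq_of_roots hu]
        simp only [pow_succ, pow_zero, one_mul, AlgHom.mul_apply, AlgHom.one_apply, h3']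
        ring
      · by_contra! hcon
        have e0 := hcon 0
        have e1 := hcon 1
        simp only [hQ] at e0 e1
        simp [pow_succ, h3', sub_eq_zero] at e0 e1
        exact h4 (e0.symm.trans e1)
      · fin_cases i
        · exact c0.ge
        · exact c1.ge
        · exact c2.ge
      · obtain ⟨j, hj⟩ := Finset.card_pos.1 (show 0 < (zeroIndices F H y).card by omega)
        rw [mem_zeroIndices_of_roots hu] at hj
        fin_cases j <;> simp [pow_succ, h3'] at hj <;> rcases hj with rfl | rfl
        exacts [⟨0, rfl⟩, ⟨1, rfl⟩, ⟨1, rfl⟩, ⟨2, rfl⟩, ⟨2, rfl⟩, ⟨0, rfl⟩]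
      · rw [natDegree_X_sub_C]
        simp [Fin.sum_univ_three, c0, c1, c2]
  · -- the conjugates of `H` are pairwise coprime
    push Not at hD
    have hQ : ∀ j, conjPoly F L j (H.map (frob F K).toRingHom *
        (H.map (frob F K).toRingHom).map (frob F K).toRingHom) =
        conjPoly F L (j + 1) H * conjPoly F L (j + 2) H := fun j => by
      rw [conjPoly_mul, conjPoly_map_frob, conjPoly_map_frob, conjPoly_map_frob]
    have h4 : conjPoly F L 4 H = conjPoly F L 1 H := by
      rw [conjPoly_succ, conjPoly_three hK, ← conjPoly_succ]
    refine ⟨H.map (frob F K).toRingHom * (H.map (frob F K).toRingHom).map (frob F K).toRingHom,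
      (hH.map _).mul ((hH.map _).map _), fun j => conjPoly_eq_of_one ?_ j, ?_, fun x => ?_,
      0, Fin.elim0, fun i => i.elim0, fun y hy => absurd hy (not_le.2 (hD y)), ?_⟩
    · rw [conjPoly_mul _ H, conjPoly_mul _ H, hQ, hQ, show 1 + 2 = 3 from rfl, conjPoly_three hK]
      ring
    · obtain ⟨r, r', h⟩ := exists_roots_of_natDegree_two hL hH hd
      rw [hQ, conjPoly_eq_of_roots h, conjPoly_eq_of_roots h]
      exact ((Splits.X_sub_C _).mul (Splits.X_sub_C _)).mul
        ((Splits.X_sub_C _).mul (Splits.X_sub_C _))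
    · by_contra! hcon
      have e0 := hcon 0
      have e1 := hcon 1
      have e2 := hcon 2
      simp only [hQ] at e0 e1 e2
      simp [conjPoly_three hK, h4] at e0 e1 e2
      have hno : ∀ i j : Fin 3, i ≠ j → (conjPoly F L i H).eval x = 0 →
          (conjPoly F L j H).eval x = 0 → False := fun i j hij hi hj =>
        absurd (Finset.one_lt_card.2 ⟨i, mem_zeroIndices.2 hi, j, mem_zeroIndices.2 hj, hij⟩)
          (not_lt.2 (Nat.lt_succ_iff.1 (hD x)))
      have n01 := hno 0 1 (by decide)
      have n02 := hno 0 2 (by decide)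
      have n12 := hno 1 2 (by decide)
      simp only [Fin.val_zero, Fin.val_one, Fin.val_two] at n01 n02 n12
      tauto
    · rw [(hH.map _).natDegree_mul ((hH.map _).map _), natDegree_map, natDegree_map,
        natDegree_map, hd]
      simp

end Cofactor

/-! ### Normal form of the conic variety and its section -/

section NormalForm

/-- The change of coordinates of `E^3` given by a basis over a subfield. -/
noncomputable def extBasisEquiv {F : Type*} [Field F] (b : Module.Basis (Fin 3) F (Fin 3 → F))
    (E : Type*) [Field E] [Algebra F E] : (Fin 3 → E) ≃ₗ[E] (Fin 3 → E) :=
  LinearEquiv.ofBijective (Fintype.linearCombination E fun m => extVec E (b m)) (by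
    have hsurj : Function.Surjective (Fintype.linearCombination E fun m => extVec E (b m)) := by
      intro c
      refine ⟨fun m => ∑ i, c i * algebraMap F E (b.repr (Pi.single i 1) m), ?_⟩
      funext l
      have hb : ∀ i, ∑ m, b.repr (Pi.single i 1) m * b m l = (Pi.single i 1 : Fin 3 → F) l :=
        fun i => by
          conv_rhs => rw [← b.sum_repr (Pi.single i 1)]
          simp
      simp only [Fintype.linearCombination_apply, Finset.sum_apply, Pi.smul_apply, smul_eq_mul,
        extVec, Finset.sum_mul, mul_assoc, ← map_mul]
      rw [Finset.sum_comm]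
      simp only [← Finset.mul_sum, ← map_sum, hb]
      simp [Pi.single_apply]
    exact ⟨LinearMap.injective_iff_surjective.2 hsurj, hsurj⟩)

theorem extBasisEquiv_apply {F : Type*} [Field F] (b : Module.Basis (Fin 3) F (Fin 3 → F))
    {E : Type*} [Field E] [Algebra F E] (z : Fin 3 → E) :
    extBasisEquiv b E z = ∑ m, z m • extVec E (b m) := by
  change Fintype.linearCombination E (fun m => extVec E (b m)) z = _
  rw [Fintype.linearCombination_apply]

theorem exists_ker_eq_of_finrank {K : Type*} [Field K] {U : Submodule K (Fin 3 → K)}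
    (hU : Module.finrank K U = 2) : ∃ h : (Fin 3 → K) →ₗ[K] K, h ≠ 0 ∧ LinearMap.ker h = U := by
  have hlt : U < ⊤ := by
    refine lt_top_iff_ne_top.2 ?_
    rintro rfl
    simp at hU
  obtain ⟨h, hh, hle⟩ := Submodule.exists_le_ker_of_lt_top U hlt
  refine ⟨h, hh, (Submodule.eq_of_le_of_finrank_eq hle ?_).symm⟩
  have h1 := LinearMap.finrank_range_add_finrank_ker h
  rw [LinearMap.range_eq_top.2 (LinearMap.surjective hh)] at h1
  simp at h1
  omega

variable {F K L : Type*} [Field F] [Finite F] [Field K] [Field L]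
  [Algebra F K] [Algebra F L] [Algebra K L] [IsScalarTower F K L]

theorem finrank_rep (hK : Module.finrank F K = 3) (B : BoseRep F K)
    {U : Submodule K (Fin 3 → K)} (hU : Module.finrank K U = 2) :
    Module.finrank F (B.rep U) = 6 := by
  have : B.rep U = (U.restrictScalars F).map (B.traceEquiv hK).toLinearMap := by
    ext w
    rw [B.mem_rep_iff hK, Submodule.mem_map_equiv]
    rfl
  rw [this, LinearEquiv.finrank_map_eq]
  have h1 := Module.finrank_mul_finrank F K U
  rw [hK, hU] at h1
  exact h1.symm

/-- In suitable coordinates `Y`, the conic is `c_0 c_2 = c_1^2`, the line at infinity has an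
equation whose coefficient at `Y_2` is `1`, and the 6-space is where its left-hand side is in
`F`. -/
theorem exists_normalForm [Finite L] (hK : Module.finrank F K = 3) (B : BoseRep F K)
    {linf : Submodule K (Fin 3 → K)} (hlinf : Module.finrank K linf = 2)
    {Sg : Submodule F (Fin 9 → F)} (hSg : Module.finrank F Sg = 7) (hinf : B.rep linf ≤ Sg)
    (C : SubConic F K) :
    ∃ (Y : (Fin 9 → F) ≃ₗ[F] (Fin 3 → K)) (η β : K),
      (∀ w, w ∈ Sg ↔ ∃ a : F, algebraMap F K a = η * Y w 0 + β * Y w 1 + Y w 2) ∧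
      (∀ w, w ∈ B.rep linf ↔ η * Y w 0 + β * Y w 1 + Y w 2 = 0) ∧
      ∀ P : ℙ L (Fin 9 → L), P ∈ (B.conicVariety hK C).points L ↔
        ∃ l c : Fin 3 → L, c 0 * c 2 = c 1 ^ 2 ∧ ∀ j i, psi hK Y P.rep j i = l j * c i := by
  obtain ⟨h, hh, hker⟩ := exists_ker_eq_of_finrank hlinf
  let hf : (Fin 3 → K) →ₗ[K] K := h.comp C.frame.toLinearMap
  let h' : (Fin 3 → F) →ₗ[F] K := Fintype.linearCombination F fun i => hf (Pi.single i 1)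
  have hh' : ∀ x, hf (extVec K x) = h' x := fun x => by
    conv_lhs => rw [pi_eq_sum_univ' (extVec K x), map_sum]
    simp only [map_smul, h', Fintype.linearCombination_apply, extVec, smul_eq_mul,
      Algebra.smul_def (R := F)]
  have h'0 : h' ≠ 0 := by
    intro h0
    apply hh
    have : hf = 0 := by
      refine LinearMap.pi_ext' fun i => LinearMap.ext_ring ?_
      have := LinearMap.congr_fun h0 (Pi.single i 1)
      simpa [h', Fintype.linearCombination_apply_single] using this
    refine LinearMap.ext fun x => ?_
    have := LinearMap.congr_fun this (C.frame.symm x)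
    simpa [hf] using this
  obtain ⟨b, κ, hκ, hb2, hb⟩ := exists_conic_basis C.homogeneous C.nonsingular h'0
  have hrep : ∀ w, w ∈ B.rep linf ↔ hf (B.frameEquiv hK C w) = 0 := fun w => by
    rw [B.mem_rep_iff hK, ← hker, LinearMap.mem_ker, B.frameEquiv_apply]
    simp [hf]
  -- the 6-space is spanned by the 5-space at infinity and one more vector `w₀`
  have hr6 := finrank_rep hK B hlinf
  obtain ⟨w₀, hw₀, hw₀'⟩ := SetLike.exists_of_lt
    (lt_of_le_of_ne hinf fun h => by rw [h, hSg] at hr6; omega)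
  set u := hf (B.frameEquiv hK C w₀) with hu
  have hu0 : u ≠ 0 := fun h => hw₀' ((hrep _).2 h)
  have hSg' : ∀ w, w ∈ Sg ↔ ∃ a : F, hf (B.frameEquiv hK C w) = algebraMap F K a * u := by
    intro w
    have hsmul : ∀ a : F, hf (B.frameEquiv hK C (a • w₀)) = algebraMap F K a * u := fun a => by
      rw [map_smul, ← algebraMap_smul K a, map_smul, smul_eq_mul]
    constructor
    · intro hw
      have hlt : B.rep linf < B.rep linf ⊔ F ∙ w₀ := by
        refine lt_of_le_of_ne le_sup_left fun h => hw₀' ?_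
        rw [h]
        exact le_sup_right (a := B.rep linf) (Submodule.mem_span_singleton_self w₀)
      have hle : B.rep linf ⊔ F ∙ w₀ ≤ Sg :=
        sup_le hinf ((Submodule.span_singleton_le_iff_mem _ _).2 hw₀)
      have hfin := Submodule.finrank_lt_finrank_of_lt hlt
      have heq := Submodule.eq_of_le_of_finrank_le hle (by omega)
      rw [← heq, Submodule.mem_sup] at hw
      obtain ⟨y, hy, z, hz, rfl⟩ := hw
      obtain ⟨a, rfl⟩ := Submodule.mem_span_singleton.1 hz
      exact ⟨a, by rw [map_add, map_add, (hrep y).1 hy, zero_add, hsmul]⟩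
    · rintro ⟨a, ha⟩
      have : w - a • w₀ ∈ B.rep linf := by
        rw [hrep, map_sub, map_sub, ha, hsmul, sub_self]
      have := Sg.add_mem (hinf this) (Sg.smul_mem a hw₀)
      simpa using this
  set s : K := h' (b 2) / u with hs
  have hs0 : s ≠ 0 := div_ne_zero hb2 hu0
  let Y' : (Fin 9 → F) ≃ₗ[F] (Fin 3 → K) :=
    (B.frameEquiv hK C).trans ((extBasisEquiv b K).symm.restrictScalars F)
  let Y : (Fin 9 → F) ≃ₗ[F] (Fin 3 → K) :=
    Y'.trans ((LinearEquiv.smulOfNeZero K (Fin 3 → K) s hs0).restrictScalars F)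
  have hY : ∀ w i, Y w i = s * Y' w i := fun w i => rfl
  have hfr : ∀ w, B.frameEquiv hK C w = ∑ m, Y' w m • extVec K (b m) := fun w => by
    rw [← extBasisEquiv_apply]
    exact ((extBasisEquiv b K).apply_symm_apply _).symm
  have hform : ∀ w, hf (B.frameEquiv hK C w) =
      (h' (b 0) / h' (b 2) * Y w 0 + h' (b 1) / h' (b 2) * Y w 1 + Y w 2) * u := fun w => by
    rw [hfr]
    simp only [Fin.sum_univ_three, map_add, map_smul, hh', smul_eq_mul, hY, hs]
    field_simp
  refine ⟨Y, h' (b 0) / h' (b 2), h' (b 1) / h' (b 2), fun w => ?_, fun w => ?_, fun P => ?_⟩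
  · rw [hSg']
    refine exists_congr fun a => ?_
    rw [hform, mul_left_inj' hu0, eq_comm]
  · rw [hrep, hform, mul_eq_zero_iff_right hu0]
  · have hpsi : ∀ j, psi hK (B.frameEquiv hK C) P.rep j = extBasisEquiv b L (psi hK Y' P.rep j) :=
      fun j => by
        rw [extBasisEquiv_apply]
        funext i
        rw [psi_apply, conjForm_eq_sum Finset.univ (fun m => extVec K (b m) i) (row Y')]
        · simp only [Finset.sum_apply, Pi.smul_apply, smul_eq_mul, psi_apply, extVec,
            AlgHom.commutes]
          exact Finset.sum_congr rfl fun _ _ => mul_comm _ _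
        · intro x
          rw [row_apply, hfr]
          simp only [Finset.sum_apply, Pi.smul_apply, smul_eq_mul, row_apply]
          exact Finset.sum_congr rfl fun _ _ => mul_comm _ _
    have hpsi' : ∀ j i, psi hK Y P.rep j i = emb F L j s * psi hK Y' P.rep j i := fun j i => by
      rw [psi_apply, conjForm_eq_sum {()} (fun _ => s) (fun _ => row Y' i)]
      · simp [psi_apply]
      · intro x
        simp [hY]
    have hsj : ∀ j : Fin 3, emb F L j s ≠ 0 := fun j => by
      simpa using hs0
    have hκ' : algebraMap F L κ ≠ 0 := by simpa using hκ
    rw [mem_conicVariety_iff_psi]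
    constructor
    · rintro ⟨l, c, hc, hlc⟩
      obtain ⟨z, rfl⟩ := (extBasisEquiv b L).surjective c
      refine ⟨fun j => emb F L j s * l j, z, ?_, fun j i => ?_⟩
      · rw [extBasisEquiv_apply, hb] at hc
        exact sub_eq_zero.1 ((mul_eq_zero.1 hc).resolve_left hκ')
      · have h1 : psi hK (B.frameEquiv hK C) P.rep j = l j • extBasisEquiv b L z :=
          funext fun i => hlc j i
        rw [hpsi, ← map_smul] at h1
        rw [hpsi', (extBasisEquiv b L).injective h1, Pi.smul_apply, smul_eq_mul, mul_assoc]
    · rintro ⟨l, z, hz, hlz⟩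
      refine ⟨fun j => (emb F L j s)⁻¹ * l j, extBasisEquiv b L z, ?_, fun j i => ?_⟩
      · rw [extBasisEquiv_apply, hb, hz, sub_self, mul_zero]
      · have h1 : psi hK Y' P.rep j = ((emb F L j s)⁻¹ * l j) • z := funext fun i => by
          have := hlz j i
          rw [hpsi'] at this
          rw [Pi.smul_apply, smul_eq_mul, mul_assoc, ← this, inv_mul_cancel_left₀ (hsj j)]
        rw [hpsi, h1, map_smul, Pi.smul_apply, smul_eq_mul]

end NormalForm

/-! ### The curve and the subspaces at infinity -/

section Curve

open Polynomial

/-- Bézout's identity for a family without common zero, one member of which splits. -/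
theorem exists_sum_mul_eq_one {L : Type*} [Field L] {ι : Type*} [Fintype ι] {Q : ι → L[X]}
    {i₀ : ι} (hne : Q i₀ ≠ 0) (hs : (Q i₀).Splits) (h : ∀ x, ∃ i, (Q i).eval x ≠ 0) :
    ∃ u : ι → L[X], ∑ i, u i * Q i = 1 := by
  rw [← Ideal.mem_span_range_iff_exists_fun, ← Ideal.eq_top_iff_one]
  by_contra htop
  set p := Submodule.IsPrincipal.generator (Ideal.span (Set.range Q)) with hp
  have hdvd : ∀ i, p ∣ Q i := fun i =>
    (Submodule.IsPrincipal.mem_iff_generator_dvd _).1 (Ideal.subset_span ⟨i, rfl⟩)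
  have hdeg : p.degree ≠ 0 := fun h0 => by
    refine htop ?_
    rw [← Ideal.span_singleton_generator (Ideal.span (Set.range Q)), ← hp,
      Ideal.span_singleton_eq_top]
    exact isUnit_iff_degree_eq_zero.2 h0
  obtain ⟨x, hx⟩ := (hs.of_dvd hne (hdvd i₀)).exists_eval_eq_zero hdeg
  obtain ⟨i, hi⟩ := h x
  exact hi (eval_eq_zero_of_dvd_of_eval_eq_zero (hdvd i) hx)

/-- If `M = H_i Q_i` for all `i` and the `Q_i` generate the unit ideal, then the products of the
`Q_i` with the polynomials of degree at most `deg H_i` span the polynomials of degree at most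
`deg M`: reduce `f = ∑ u_i f Q_i` modulo `X M = (X H_i) Q_i`. -/
theorem exists_eq_sum_mul_of_sum_mul_eq_one {L : Type*} [Field L] {ι : Type*} [Fintype ι]
    {M : L[X]} {H Q u : ι → L[X]} (hH : ∀ i, (H i).Monic) (hQ : ∀ i, (Q i).Monic)
    (hM : ∀ i, H i * Q i = M) (hu : ∑ i, u i * Q i = 1) {d : ℕ} (hd : ∀ i, (H i).natDegree = d)
    (hMm : M.Monic) {f : L[X]} (hf : f.natDegree ≤ M.natDegree) :
    ∃ r : ι → L[X], (∀ i, (r i).natDegree ≤ d) ∧ f = ∑ i, Q i * r i := by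
  have hXH : ∀ i, (X * H i).Monic := fun i => monic_X.mul (hH i)
  have hXM : (X * M).Monic := monic_X.mul hMm
  have hXMd : (X * M).natDegree = M.natDegree + 1 := by
    rw [monic_X.natDegree_mul hMm, natDegree_X, add_comm]
  have hr : ∀ i, ((u i * f) %ₘ (X * H i)).natDegree ≤ d := fun i => by
    have h1 : (X * H i).natDegree = d + 1 := by
      rw [monic_X.natDegree_mul (hH i), natDegree_X, hd, add_comm]
    have := natDegree_modByMonic_lt (u i * f) (hXH i) (fun h => by rw [h] at h1; simp at h1)
    omega
  refine ⟨fun i => (u i * f) %ₘ (X * H i), hr, ?_⟩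
  refine sub_eq_zero.1 (eq_zero_of_dvd_of_degree_lt (p := X * M) ?_ ?_)
  · refine ⟨∑ i, (u i * f) /ₘ (X * H i), ?_⟩
    have hi : ∀ i, u i * f * Q i =
        Q i * ((u i * f) %ₘ (X * H i)) + X * M * ((u i * f) /ₘ (X * H i)) := fun i => by
      conv_lhs => rw [← modByMonic_add_div (u i * f) (X * H i)]
      rw [← hM i]
      ring
    have hsum : f = ∑ i, u i * f * Q i := by
      have := congrArg (f * ·) hu
      simp only [Finset.mul_sum, mul_one] at this
      exact this.symm.trans (Finset.sum_congr rfl fun i _ => by ring)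
    rw [sub_eq_iff_eq_add']
    refine hsum.trans ?_
    simp only [hi, Finset.sum_add_distrib, Finset.mul_sum]
  · rw [degree_eq_natDegree hXM.ne_zero, hXMd]
    refine degree_le_natDegree.trans_lt (Nat.cast_lt.2 (Nat.lt_succ_of_le ?_))
    refine (natDegree_sub_le_of_le hf (natDegree_sum_le_of_forall_le (n := M.natDegree) _ _
      fun i _ => ?_)).trans (max_self _).le
    refine natDegree_mul_le.trans ?_
    rw [← hM i, (hH i).natDegree_mul (hQ i), hd, add_comm]
    exact Nat.add_le_add_right (hr i) _

section

variable {F K : Type*} [Field F] [Field K] [Algebra F K] {n : ℕ}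

/-- The equation of the line at infinity in the coordinates `Y`. -/
noncomputable def infForm (Y : (Fin n → F) ≃ₗ[F] (Fin 3 → K)) (η β : K) :
    (Fin n → F) →ₗ[F] K :=
  η • row Y 0 + β • row Y 1 + row Y 2

theorem infForm_apply (Y : (Fin n → F) ≃ₗ[F] (Fin 3 → K)) (η β : K) (w : Fin n → F) :
    infForm Y η β w = η * Y w 0 + β * Y w 1 + Y w 2 := rfl

theorem infForm_surjective (Y : (Fin n → F) ≃ₗ[F] (Fin 3 → K)) (η β : K) :
    Function.Surjective (infForm Y η β) := fun a =>
  ⟨Y.symm (Pi.single 2 a), by simp [infForm_apply]⟩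

end

variable {F K L : Type*} [Field F] [Finite F] [Field K] [Field L]
  [Algebra F K] [Algebra F L] [Algebra K L] [IsScalarTower F K L]

/-- The dehomogenized equation of the line at infinity on the conic `(1, x, x^2)`. -/
noncomputable def infPoly (η β : K) : K[X] := X ^ 2 + C β * X + C η

theorem infPoly_monic (η β : K) : (infPoly η β).Monic := by
  rw [infPoly]; monicity!

theorem infPoly_natDegree (η β : K) : (infPoly η β).natDegree = 2 := by
  rw [infPoly]; compute_degree!

theorem conjForm_infForm [Finite L] (hK : Module.finrank F K = 3)
    (Y : (Fin 9 → F) ≃ₗ[F] (Fin 3 → K)) (η β : K) (j : Fin 3) (v : Fin 9 → L) :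
    conjForm j (infForm Y η β) v =
      emb F L j η * psi hK Y v j 0 + emb F L j β * psi hK Y v j 1 + psi hK Y v j 2 := by
  rw [conjForm_eq_sum Finset.univ ![η, β, 1] (row Y)]
  · simp [Fin.sum_univ_three, psi_apply]
  · intro x
    simp [Fin.sum_univ_three, infForm_apply]

theorem eval_conjPoly_infPoly (η β : K) (j : ℕ) (x : L) :
    (conjPoly F L j (infPoly η β)).eval x = emb F L j η + emb F L j β * x + x ^ 2 := by
  simp [conjPoly, infPoly]
  ring

theorem conjForm_infForm_of_psi [Finite L] (hK : Module.finrank F K = 3)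
    {Y : (Fin 9 → F) ≃ₗ[F] (Fin 3 → K)} {v : Fin 9 → L} {l : Fin 3 → L} {x : L}
    (h : ∀ j i, psi hK Y v j i = l j * x ^ (i : ℕ)) (η β : K) (j : Fin 3) :
    conjForm j (infForm Y η β) v = l j * (conjPoly F L j (infPoly η β)).eval x := by
  rw [conjForm_infForm hK, h, h, h, eval_conjPoly_infPoly]
  simp only [Fin.val_zero, Fin.val_one, Fin.val_two]
  ring

/-- The vectors of the normal rational curve with cofactor `Q`: in the coordinates `Y`, its affine
points are `Q(x) (1, x, x^2)`. -/
noncomputable def curveVec {n : ℕ} (Y : (Fin n → F) ≃ₗ[F] (Fin 3 → K)) (Q : K[X])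
    (i : Fin (Q.natDegree + 2 + 1)) : Fin n → F :=
  Y.symm fun m => (Q * X ^ (m : ℕ)).coeff i

theorem natDegree_mul_X_pow_lt (Q : K[X]) (m : Fin 3) :
    (Q * X ^ (m : ℕ)).natDegree < Q.natDegree + 2 + 1 := by
  have h1 := natDegree_mul_le (p := Q) (q := X ^ (m : ℕ))
  rw [natDegree_X_pow] at h1
  omega

theorem psi_sum_curveVec [Finite L] (hK : Module.finrank F K = 3)
    (Y : (Fin 9 → F) ≃ₗ[F] (Fin 3 → K)) (Q : K[X]) (x : L) (j i : Fin 3) :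
    psi hK Y (∑ n : Fin (Q.natDegree + 2 + 1), x ^ (n : ℕ) • extVec L (curveVec Y Q n)) j i =
      (conjPoly F L j Q).eval x * x ^ (i : ℕ) := by
  have h1 : (conjPoly F L j Q).eval x * x ^ (i : ℕ) =
      (conjPoly F L j (Q * X ^ (i : ℕ))).eval x := by
    rw [conjPoly_mul]; simp [conjPoly]
  rw [h1, eval_eq_sum_range' (p := conjPoly F L j (Q * X ^ (i : ℕ))) (n := Q.natDegree + 2 + 1)
    (natDegree_map_le.trans_lt (natDegree_mul_X_pow_lt Q i)), Finset.sum_range]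
  simp only [map_sum, map_smul, Finset.sum_apply, Pi.smul_apply, psi_extVec, curveVec,
    LinearEquiv.apply_symm_apply, smul_eq_mul, conjPoly, coeff_map]
  exact Finset.sum_congr rfl fun _ _ => mul_comm _ _

theorem psi_curveVec_last [Finite L] (hK : Module.finrank F K = 3)
    (Y : (Fin 9 → F) ≃ₗ[F] (Fin 3 → K)) {Q : K[X]} (hQ : Q.Monic) (j i : Fin 3) :
    psi hK Y (extVec L (curveVec Y Q (Fin.last _))) j i = if i = 2 then 1 else 0 := by
  rw [psi_extVec, curveVec, LinearEquiv.apply_symm_apply]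
  have h1 := coeff_mul_X_pow' Q (i : ℕ) (Q.natDegree + 2)
  rw [Fin.val_last, h1]
  fin_cases i
  · simp [coeff_eq_zero_of_natDegree_lt]
  · simp
  · simp [hQ]

/-- The section of the conic variety at infinity above the point `(1, x, x^2)`: the pure tensors
`l ⊗ (1, x, x^2)` with `l` supported on the conjugates of `H` that vanish at `x`. -/
noncomputable def fiberAtInfinity [Finite L] (hK : Module.finrank F K = 3)
    (Y : (Fin 9 → F) ≃ₗ[F] (Fin 3 → K)) (H : K[X]) (x : L) : Submodule L (Fin 9 → L) :=
  LinearMap.range (((psi hK Y).symm.toLinearMap.comp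
    (LinearMap.pi fun j : Fin 3 => LinearMap.pi fun i : Fin 3 =>
      x ^ (i : ℕ) • LinearMap.proj (R := L) (φ := fun _ : Fin 3 => L) j)).comp
    (Function.ExtendByZero.linearMap L (Subtype.val : zeroIndices F H x → Fin 3)))

theorem mem_fiberAtInfinity [Finite L] (hK : Module.finrank F K = 3)
    {Y : (Fin 9 → F) ≃ₗ[F] (Fin 3 → K)} {H : K[X]} {x : L} {v : Fin 9 → L} :
    v ∈ fiberAtInfinity hK Y H x ↔ ∃ l : Fin 3 → L, (∀ j, l j * (conjPoly F L j H).eval x = 0) ∧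
      ∀ j i, psi hK Y v j i = l j * x ^ (i : ℕ) := by
  constructor
  · rintro ⟨a, rfl⟩
    refine ⟨Function.extend Subtype.val a 0, fun j => ?_, fun j i => ?_⟩
    · by_cases hj : j ∈ zeroIndices F H x
      · rw [mem_zeroIndices.1 hj, mul_zero]
      · rw [Function.extend_apply' _ _ _ (by rintro ⟨y, rfl⟩; exact hj y.2), Pi.zero_apply,
          zero_mul]
    · simp [mul_comm]
  · rintro ⟨l, hl, h⟩
    refine ⟨fun j => l j, (psi hK Y).injective ?_⟩
    funext j i
    rw [h]
    have : Function.extend Subtype.val (fun j : zeroIndices F H x => l j) 0 j = l j := by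
      by_cases hj : j ∈ zeroIndices F H x
      · exact Subtype.val_injective.extend_apply _ _ (⟨j, hj⟩ : zeroIndices F H x)
      · rw [Function.extend_apply' _ _ _ (by rintro ⟨y, rfl⟩; exact hj y.2), Pi.zero_apply]
        rw [mem_zeroIndices] at hj
        exact ((mul_eq_zero.1 (hl j)).resolve_right hj).symm
    simp [this, mul_comm]

theorem finrank_fiberAtInfinity [Finite L] (hK : Module.finrank F K = 3)
    (Y : (Fin 9 → F) ≃ₗ[F] (Fin 3 → K)) (H : K[X]) (x : L) :
    Module.finrank L (fiberAtInfinity hK Y H x) = (zeroIndices F H x).card := by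
  rw [fiberAtInfinity, LinearMap.finrank_range_of_inj]
  · simp
  · intro a b hab
    have h := (psi hK Y).symm.injective hab
    funext j
    have hj := congrFun (congrFun h j) 0
    simpa [Subtype.val_injective.extend_apply] using hj

theorem eq_of_fiberAtInfinity_le [Finite L] (hK : Module.finrank F K = 3)
    {Y : (Fin 9 → F) ≃ₗ[F] (Fin 3 → K)} {H : K[X]} {x y : L}
    (hx : 0 < (zeroIndices F H x).card)
    (h : fiberAtInfinity hK Y H x ≤ fiberAtInfinity hK Y H y) : x = y := by
  obtain ⟨j, hj⟩ := Finset.card_pos.1 hx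
  have hv : (psi hK Y).symm (fun j' i => Pi.single (M := fun _ => L) j 1 j' * x ^ (i : ℕ)) ∈
      fiberAtInfinity hK Y H x := by
    refine (mem_fiberAtInfinity hK).2 ⟨Pi.single j 1, fun j' => ?_, fun j' i => by simp⟩
    rcases eq_or_ne j' j with rfl | hne
    · rw [mem_zeroIndices.1 hj, mul_zero]
    · rw [Pi.single_eq_of_ne hne, zero_mul]
  obtain ⟨l, -, hl⟩ := (mem_fiberAtInfinity hK).1 (h hv)
  have h0 := hl j 0
  have h1 := hl j 1
  simp only [LinearEquiv.apply_symm_apply, Pi.single_eq_same, Fin.val_zero, Fin.val_one, pow_zero,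
    pow_one, mul_one, one_mul] at h0 h1
  rw [h1, ← h0, one_mul]

theorem fiberAtInfinity_le [Finite L] (hK : Module.finrank F K = 3)
    {Y : (Fin 9 → F) ≃ₗ[F] (Fin 3 → K)} {η β : K} {U : Submodule F (Fin 9 → F)}
    (hU : ∀ w, w ∈ U ↔ infForm Y η β w = 0) (x : L) :
    fiberAtInfinity hK Y (infPoly η β) x ≤ extSubspace L U := by
  intro v hv
  obtain ⟨l, hl, h⟩ := (mem_fiberAtInfinity hK).1 hv
  refine mem_extSubspace_of_conjForm_eq_zero hK (infForm_surjective Y η β) hU fun j => ?_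
  rw [conjForm_infForm_of_psi hK h, hl]

end Curve

/-! ### Decomposition of the section -/

section Decomposition

open Polynomial

theorem infForm_curveVec {F K : Type*} [Field F] [Field K] [Algebra F K] {n : ℕ}
    (Y : (Fin n → F) ≃ₗ[F] (Fin 3 → K)) (η β : K) (Q : K[X])
    (i : Fin (Q.natDegree + 2 + 1)) :
    infForm Y η β (curveVec Y Q i) = (infPoly η β * Q).coeff i := by
  rw [infForm_apply, curveVec, LinearEquiv.apply_symm_apply]
  have : infPoly η β * Q = C η * (Q * X ^ 0) + C β * (Q * X ^ 1) + Q * X ^ 2 := by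
    rw [infPoly]; ring
  rw [this, coeff_add, coeff_add, coeff_C_mul, coeff_C_mul]
  simp only [Fin.val_zero, Fin.val_one, Fin.val_two]

variable {F K L : Type*} [Field F] [Finite F] [Field K] [Field L]
  [Algebra F K] [Algebra F L] [Algebra K L] [IsScalarTower F K L]

theorem natDegree_conjPoly (j : ℕ) (p : K[X]) : (conjPoly F L j p).natDegree = p.natDegree :=
  natDegree_map _

theorem conjPoly_monic (j : ℕ) {p : K[X]} (hp : p.Monic) : (conjPoly F L j p).Monic := hp.map _

/-- The vectors of the curve are independent: a linear form on the polynomials of degree at most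
`k` that kills `Q_j`, `X Q_j` and `X^2 Q_j` for every conjugate `Q_j` of `Q` is zero. -/
theorem linearIndependent_curveVec {n : ℕ} (Y : (Fin n → F) ≃ₗ[F] (Fin 3 → K)) {H Q : K[X]}
    (hH : H.Monic) (hd : H.natDegree = 2) (hQ : Q.Monic)
    (hHQ : ∀ j, conjPoly F L j (H * Q) = conjPoly F L 0 (H * Q))
    (hs : (conjPoly F L 0 Q).Splits)
    (hx : ∀ x : L, ∃ j : Fin 3, (conjPoly F L j Q).eval x ≠ 0) :
    LinearIndependent F (curveVec Y Q) := by
  rw [Fintype.linearIndependent_iff]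
  intro a ha
  obtain ⟨u, hu⟩ := exists_sum_mul_eq_one (Q := fun j : Fin 3 => conjPoly F L j Q) (i₀ := 0)
    (conjPoly_monic 0 hQ).ne_zero hs hx
  let A : L[X] →ₗ[L] L :=
    ∑ i : Fin (Q.natDegree + 2 + 1), algebraMap F L (a i) • Polynomial.lcoeff L i
  have hA : ∀ p, A p = ∑ i : Fin (Q.natDegree + 2 + 1), algebraMap F L (a i) * p.coeff i :=
    fun p => by simp [A, Algebra.smul_def]
  have hK : ∀ m : Fin 3, ∑ i : Fin (Q.natDegree + 2 + 1),
      algebraMap F K (a i) * (Q * X ^ (m : ℕ)).coeff i = 0 := fun m => by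
    have h1 := congrFun (congrArg Y ha) m
    simp only [map_sum, map_smul, curveVec, LinearEquiv.apply_symm_apply, Finset.sum_apply,
      Pi.smul_apply, map_zero, Pi.zero_apply] at h1
    simpa only [Algebra.smul_def] using h1
  have hkill : ∀ (j : Fin 3) (m : Fin 3), A (conjPoly F L j Q * X ^ (m : ℕ)) = 0 := fun j m => by
    have h1 := congrArg (emb F L j) (hK m)
    rw [hA]
    simp only [map_sum, map_mul, AlgHom.commutes, map_zero] at h1
    rw [← h1]
    have h2 : conjPoly F L j Q * X ^ (m : ℕ) = conjPoly F L j (Q * X ^ (m : ℕ)) := by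
      rw [conjPoly_mul]; simp [conjPoly]
    rw [h2]
    simp only [conjPoly, coeff_map]
    rfl
  have hkill' : ∀ (j : Fin 3) (r : L[X]), r.natDegree ≤ 2 → A (conjPoly F L j Q * r) = 0 := by
    intro j r hr
    conv_lhs => rw [r.as_sum_range' 3 (by omega)]
    rw [Finset.mul_sum, map_sum, Finset.sum_range]
    refine Finset.sum_eq_zero fun m _ => ?_
    rw [← C_mul_X_pow_eq_monomial, mul_left_comm, ← smul_eq_C_mul, map_smul, hkill, smul_zero]
  intro i
  have hdeg : (conjPoly F L 0 (H * Q)).natDegree = Q.natDegree + 2 := by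
    rw [natDegree_conjPoly, hH.natDegree_mul hQ, hd, add_comm]
  obtain ⟨r, hr, hf⟩ := exists_eq_sum_mul_of_sum_mul_eq_one (M := conjPoly F L 0 (H * Q))
    (H := fun j : Fin 3 => conjPoly F L j H) (Q := fun j : Fin 3 => conjPoly F L j Q) (d := 2)
    (f := X ^ (i : ℕ)) (fun j => conjPoly_monic j hH) (fun j => conjPoly_monic j hQ)
    (fun j => by rw [← conjPoly_mul, hHQ]) hu (fun j => by rw [natDegree_conjPoly, hd])
    (conjPoly_monic 0 (hH.mul hQ)) (by rw [natDegree_X_pow, hdeg]; omega)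
  have h0 : A (X ^ (i : ℕ)) = 0 := by
    rw [hf, map_sum]
    exact Finset.sum_eq_zero fun j _ => hkill' j _ (hr j)
  rw [hA] at h0
  simpa [coeff_X_pow, Fin.val_inj, Finset.sum_ite_eq'] using h0

theorem exists_infForm_curveVec [Finite K] {n : ℕ} (Y : (Fin n → F) ≃ₗ[F] (Fin 3 → K)) (η β : K)
    {Q : K[X]} (hHQ : conjPoly F L 1 (infPoly η β * Q) = conjPoly F L 0 (infPoly η β * Q))
    (i : Fin (Q.natDegree + 2 + 1)) :
    ∃ a : F, algebraMap F K a = infForm Y η β (curveVec Y Q i) := by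
  rw [infForm_curveVec]
  refine mem_range_of_frob_eq F ?_
  have h1 := congrArg (fun p => p.coeff (i : ℕ)) hHQ
  simp only [conjPoly, coeff_map] at h1
  change emb F L (0 + 1) _ = emb F L 0 _ at h1
  rw [← emb_frob] at h1
  exact (emb F L 0).toRingHom.injective h1

section Points

variable [Finite L] (hK : Module.finrank F K = 3) (Y : (Fin 9 → F) ≃ₗ[F] (Fin 3 → K)) {η β : K}
  {Q : K[X]}

/-- Over `L`, a pure tensor of the conic variety that lies in the 6-space is on the normal rational
curve or in the fiber above a common zero of two conjugates of the equation at infinity. -/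
theorem mem_normalRationalCurve_or_mem_fiberAtInfinity (hQ : Q.Monic)
    (hHQ : ∀ j, conjPoly F L j (infPoly η β * Q) = conjPoly F L 0 (infPoly η β * Q))
    (hx : ∀ x : L, ∃ j : Fin 3, (conjPoly F L j Q).eval x ≠ 0)
    {v : Fin 9 → L} {l c : Fin 3 → L} (hc : c 0 * c 2 = c 1 ^ 2)
    (hlc : ∀ j i, psi hK Y v j i = l j * c i) {z : L}
    (hz : ∀ j : Fin 3, conjForm j (infForm Y η β) v = z) :
    ((∃ x a : L, v = a • ∑ n : Fin (Q.natDegree + 2 + 1),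
        x ^ (n : ℕ) • extVec L (curveVec Y Q n)) ∨
      ∃ a : L, v = a • extVec L (curveVec Y Q (Fin.last _))) ∨
      ∃ x : L, 2 ≤ (zeroIndices F (infPoly η β) x).card ∧
        v ∈ fiberAtInfinity hK Y (infPoly η β) x := by
  rcases eq_or_ne (c 0) 0 with h0 | h0
  · have h1 : c 1 = 0 := by
      rw [h0, zero_mul] at hc
      exact pow_eq_zero_iff two_ne_zero |>.1 hc.symm
    refine .inl (.inr ⟨z, (psi hK Y).injective ?_⟩)
    funext j i
    have hj := hz j
    rw [conjForm_infForm hK, hlc, hlc, hlc, h0, h1] at hj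
    simp only [mul_zero, zero_add] at hj
    rw [map_smul, Pi.smul_apply, Pi.smul_apply, psi_curveVec_last hK Y hQ, hlc]
    fin_cases i
    · simp [h0]
    · simp [h1]
    · simpa using hj
  · set x := c 1 / c 0 with hxdef
    set l' : Fin 3 → L := fun j => l j * c 0 with hl'
    have hpsi : ∀ j i, psi hK Y v j i = l' j * x ^ (i : ℕ) := fun j i => by
      rw [hlc, hl', hxdef]
      fin_cases i
      · simp
      · simp; field_simp
      · simp only [Fin.reduceFinMk]
        field_simp
        linear_combination l j * hc
    have hform : ∀ j : Fin 3, l' j * (conjPoly F L j (infPoly η β)).eval x = z := fun j => by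
      rw [← conjForm_infForm_of_psi hK hpsi, hz]
    by_cases hcard : 2 ≤ (zeroIndices F (infPoly η β) x).card
    · refine .inr ⟨x, hcard, (mem_fiberAtInfinity hK).2 ⟨l', fun j => ?_, hpsi⟩⟩
      -- some conjugate vanishes at `x`, so the common value `z` is zero
      obtain ⟨i, hi⟩ := Finset.card_pos.1 (show 0 < (zeroIndices F (infPoly η β) x).card by omega)
      rw [hform, ← hform i, mem_zeroIndices.1 hi, mul_zero]
    · left; left
      obtain ⟨j₀, hj₀⟩ := hx x
      have hM : ∀ j : Fin 3, (conjPoly F L j (infPoly η β)).eval x * (conjPoly F L j Q).eval x =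
          (conjPoly F L 0 (infPoly η β * Q)).eval x := fun j => by
        rw [← eval_mul, ← conjPoly_mul, hHQ]
      -- `l'` and `(Q_j(x))_j` are proportional: `H_j(x)` times either does not depend on `j`, and at
      -- most one `H_j(x)` is zero
      have key : ∀ j : Fin 3, l' j * (conjPoly F L j₀ Q).eval x =
          l' j₀ * (conjPoly F L j Q).eval x := by
        intro j
        rcases eq_or_ne j j₀ with rfl | hne
        · rfl
        have e1 := hform j
        have e2 := hform j₀
        have m1 := hM j
        have m2 := hM j₀
        rw [← m2] at m1
        rw [← e2] at e1
        by_cases hz1 : (conjPoly F L j (infPoly η β)).eval x = 0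
        · by_cases hz2 : (conjPoly F L j₀ (infPoly η β)).eval x = 0
          · exact absurd (Finset.one_lt_card.2
              ⟨j, mem_zeroIndices.2 hz1, j₀, mem_zeroIndices.2 hz2, hne⟩) hcard
          · rw [hz1, zero_mul] at m1
            exact absurd (mul_eq_zero.1 m1.symm) (by simp [hz2, hj₀])
        · by_cases hz2 : (conjPoly F L j₀ (infPoly η β)).eval x = 0
          · rw [hz2, zero_mul] at m1
            rw [hz2, mul_zero] at e1
            rw [(mul_eq_zero.1 m1).resolve_left hz1, (mul_eq_zero.1 e1).resolve_right hz1]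
            ring
          · refine mul_left_cancel₀ (mul_ne_zero hz1 hz2) ?_
            linear_combination ((conjPoly F L j₀ Q).eval x *
              (conjPoly F L j₀ (infPoly η β)).eval x) * e1 -
              (conjPoly F L j₀ (infPoly η β)).eval x * l' j₀ * m1
      refine ⟨x, l' j₀ / (conjPoly F L j₀ Q).eval x, (psi hK Y).injective ?_⟩
      funext j i
      rw [map_smul, Pi.smul_apply, Pi.smul_apply, psi_sum_curveVec hK, hpsi, smul_eq_mul]
      field_simp
      linear_combination x ^ (i : ℕ) * key j

end Points

/-- All but at most two points of the curve are affine: the parameters of the others are zeros of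
the quadratic polynomial of the line at infinity. -/
theorem card_sub_one_le_ncard (Y : (Fin 9 → F) ≃ₗ[F] (Fin 3 → K)) {η β : K} {Q : K[X]}
    (hQ : Q.Monic) (hHQ : ∀ j, conjPoly F L j (infPoly η β * Q) = conjPoly F L 0 (infPoly η β * Q))
    (hx : ∀ x : L, ∃ j : Fin 3, (conjPoly F L j Q).eval x ≠ 0)
    (hli : LinearIndependent F (curveVec Y Q)) {U : Submodule F (Fin 9 → F)}
    (hU : ∀ w, w ∈ U ↔ infForm Y η β w = 0) :
    Nat.card F - 1 ≤ (normalRationalCurve (curveVec Y Q) F \ pointsOf U).ncard := by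
  classical
  have _ := Fintype.ofFinite F
  obtain ⟨u, hu⟩ := exists_dual_of_linearIndependent hli
  set p : F → Fin 9 → F := fun x => ∑ i : Fin (Q.natDegree + 2 + 1),
    x ^ (i : ℕ) • extVec F (curveVec Y Q i) with hp
  have hup : ∀ x i, u i (p x) = x ^ (i : ℕ) := fun x i => by
    have := extForm_sum_smul_dual (E := F) hu (fun i => x ^ (i : ℕ)) i
    rw [← this]
    exact (extForm_extVec (toExt F (u i)) (p x)).symm
  have hp0 : ∀ x, p x ≠ 0 := fun x h => by
    have := hup x 0
    rw [h] at this
    simp at this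
  have hlast : curveVec Y Q (Fin.last _) ≠ 0 := hli.ne_zero _
  set T := Finset.univ.filter fun x : F => (infPoly η β).eval (algebraMap F K x) ≠ 0 with hT
  set N : F → ℙ F (Fin 9 → F) := fun x => Projectivization.mk F (p x) (hp0 x) with hN
  set N' := Projectivization.mk F _ hlast with hN'
  have hNinj : Function.Injective N := by
    intro x y hxy
    obtain ⟨a, ha⟩ := (Projectivization.mk_eq_mk_iff F _ _ _ _).1 hxy
    have e0 := congrArg (u 0) ha
    have e1 := congrArg (u ⟨1, by omega⟩) ha
    rw [Units.smul_def, map_smul, hup, hup] at e0 e1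
    simp only [Fin.val_zero, pow_zero, smul_eq_mul, mul_one, pow_one] at e0 e1
    rw [e0, one_mul] at e1
    exact e1.symm
  have hN'N : N' ∉ T.image N := by
    rw [Finset.mem_image]
    rintro ⟨x, -, hxy⟩
    obtain ⟨a, ha⟩ := (Projectivization.mk_eq_mk_iff F _ _ _ _).1 hxy
    have e0 := congrArg (u 0) ha
    rw [Units.smul_def, map_smul, hup, hu, if_neg (by simp [Fin.ext_iff])] at e0
    simp at e0
  have hcard : Nat.card F - 1 ≤ (insert N' (T.image N)).card := by
    rw [Finset.card_insert_of_notMem hN'N, Finset.card_image_of_injective _ hNinj]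
    have h1 := Finset.card_filter_add_card_filter_not (s := (Finset.univ : Finset F))
      (fun x : F => (infPoly η β).eval (algebraMap F K x) ≠ 0)
    have h2 : (Finset.univ.filter fun x : F =>
        ¬ (infPoly η β).eval (algebraMap F K x) ≠ 0).card ≤ 2 := by
      rw [← infPoly_natDegree η β]
      refine le_trans ?_ ((infPoly η β).roots.toFinset_card_le.trans (card_roots' _))
      refine Finset.card_le_card_of_injOn (algebraMap F K) (fun x hx => ?_)
        (algebraMap F K).injective.injOn
      have := (Finset.mem_filter.1 hx).2
      simpa [(infPoly_monic η β).ne_zero] using this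
    rw [Finset.card_univ, ← Nat.card_eq_fintype_card] at h1
    change T.card + _ = _ at h1
    omega
  refine hcard.trans ?_
  rw [← Set.ncard_coe_finset]
  refine Set.ncard_le_ncard ?_ (Set.toFinite _)
  intro P hP
  rw [Finset.mem_coe, Finset.mem_insert, Finset.mem_image] at hP
  rcases hP with rfl | ⟨x, hxT, rfl⟩
  · refine ⟨(mk_mem_normalRationalCurve _ _).2 (.inr ⟨1, by rw [one_smul]; rfl⟩), ?_⟩
    rw [mk_mem_pointsOf, hU, infForm_curveVec]
    have h1 : ((infPoly η β) * Q).natDegree = Q.natDegree + 2 := by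
      rw [(infPoly_monic η β).natDegree_mul hQ, infPoly_natDegree, add_comm]
    rw [Fin.val_last, ← h1, ((infPoly_monic η β).mul hQ).coeff_natDegree]
    exact one_ne_zero
  · refine ⟨(mk_mem_normalRationalCurve _ _).2 (.inl ⟨x, 1, by rw [one_smul]⟩), ?_⟩
    rw [mk_mem_pointsOf, hU]
    have h1 : infForm Y η β (p x) = (infPoly η β * Q).eval (algebraMap F K x) := by
      have hdeg : ((infPoly η β) * Q).natDegree < Q.natDegree + 2 + 1 := by
        rw [(infPoly_monic η β).natDegree_mul hQ, infPoly_natDegree]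
        omega
      rw [eval_eq_sum_range' hdeg, Finset.sum_range, hp, map_sum]
      refine Finset.sum_congr rfl fun i _ => ?_
      rw [map_smul, Algebra.smul_def, map_pow, mul_comm]
      congr 1
      exact infForm_curveVec Y η β Q i
    rw [h1]
    -- if `H Q` vanished at `x` in `F`, every conjugate of `Q` would, since none of `H` does
    intro h0
    have hxH := (Finset.mem_filter.1 hxT).2
    have hev : ∀ (j : ℕ) (q : K[X]), (conjPoly F L j q).eval (algebraMap F L x) =
        emb F L j (q.eval (algebraMap F K x)) := fun j q => by
      rw [conjPoly, ← AlgHom.commutes (emb F L j : K →ₐ[F] L) x]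
      exact eval_map_apply _ _
    obtain ⟨j, hj⟩ := hx (algebraMap F L x)
    have h2 := congrArg (eval (algebraMap F L x)) (hHQ j)
    rw [conjPoly_mul, eval_mul, hev, hev 0, h0, map_zero] at h2
    rcases mul_eq_zero.1 h2 with h3 | h3
    · exact hxH (by simpa using h3)
    · exact hj h3

end Decomposition
end BoseBruck

theorem mainTheorem3 {F K L : Type*} [Field F] [Finite F] [Field K] [Field L]
    [Algebra F K] [Algebra F L] [Algebra K L] [IsScalarTower F K L]
    (hK : Module.finrank F K = 3) (hL : Module.finrank K L = 2)
    (B : BoseRep F K)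
    (linf : Submodule K (Fin 3 → K)) (hlinf : Module.finrank K linf = 2)
    (Sg : Submodule F (Fin 9 → F)) (hSg : Module.finrank F Sg = 7) (hinf : B.rep linf ≤ Sg)
    (C : SubConic F K) :
    (B.bruckBoseVariety hK Sg C).points F = B.bruckBose Sg C ∧
    (B.bruckBoseVariety hK Sg C).points K =
      (B.conicVariety hK C).points K ∩ pointsOf (extSubspace K Sg) ∧
    (B.bruckBoseVariety hK Sg C).points L =
      (B.conicVariety hK C).points L ∩ pointsOf (extSubspace L Sg) ∧
    ∃ k : ℕ, 2 ≤ k ∧ k ≤ 6 ∧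
      ∃ e : Fin (k + 1) → Fin 9 → F, LinearIndependent F e ∧ (∀ i, e i ∈ Sg) ∧
        Nat.card F - 1 ≤ (normalRationalCurve e F \ pointsOf (B.rep linf)).ncard ∧
      ∃ (m : ℕ) (S : Fin m → Submodule L (Fin 9 → L)),
        (∀ i, Module.finrank L (S i) = 2 ∨ Module.finrank L (S i) = 3) ∧
        (∀ i, S i ≤ extSubspace L (B.rep linf)) ∧
        (∀ i j, S i ≤ S j → S i = S j) ∧
        k + ∑ i, (Module.finrank L (S i) - 1) = 6 ∧
        (B.bruckBoseVariety hK Sg C).points F =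
          normalRationalCurve e F ∪ ⋃ i, pointsOf (subfieldPart F (S i)) ∧
        (B.bruckBoseVariety hK Sg C).points K =
          normalRationalCurve e K ∪ ⋃ i, pointsOf (subfieldPart K (S i)) ∧
        (B.bruckBoseVariety hK Sg C).points L =
          normalRationalCurve e L ∪ ⋃ i, pointsOf (S i) := by
  have : FiniteDimensional F K := Module.finite_of_finrank_eq_succ hK
  have : Finite K := Module.finite_of_finite F
  have : FiniteDimensional K L := Module.finite_of_finrank_eq_succ hL
  have : Finite L := Module.finite_of_finite K
  refine ⟨bruckBoseVariety_points_self hK B Sg C, bruckBoseVariety_points hK B Sg C K,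
    bruckBoseVariety_points hK B Sg C L, ?_⟩
  obtain ⟨Y, η, β, hYS, hYi, hYC⟩ := exists_normalForm (L := L) hK B hlinf hSg hinf C
  obtain ⟨Q, hQ, hHQ, hs, hx, m, x, hx2, hxall, hsum⟩ :=
    exists_cofactor (F := F) hK hL (infPoly_monic η β) (infPoly_natDegree η β)
  have hli := linearIndependent_curveVec Y (infPoly_monic η β) (infPoly_natDegree η β) hQ hHQ hs hx
  have hfr := fun y : L => finrank_fiberAtInfinity hK Y (infPoly η β) y
  have hle3 : ∀ y : L, (zeroIndices F (infPoly η β) y).card ≤ 3 := fun y => by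
    simpa using Finset.card_le_univ (zeroIndices F (infPoly η β) y)
  have hLpts : (B.bruckBoseVariety hK Sg C).points L = normalRationalCurve (curveVec Y Q) L ∪
      ⋃ i, pointsOf (fiberAtInfinity hK Y (infPoly η β) (x i)) := by
    rw [bruckBoseVariety_points]
    ext P
    rw [Set.mem_inter_iff, hYC, mem_pointsOf, Set.mem_union, Set.mem_iUnion,
      mem_normalRationalCurve, mem_extSubspace_of_conjForm_eq hK (infForm_surjective Y η β) hYS]
    simp only [mem_pointsOf]
    constructor
    · rintro ⟨⟨l, c, hc, hlc⟩, z, hz⟩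
      rcases mem_normalRationalCurve_or_mem_fiberAtInfinity hK Y hQ hHQ hx hc hlc hz
        with h | ⟨y, hy, hv⟩
      · exact .inl h
      · obtain ⟨i, rfl⟩ := hxall y hy
        exact .inr ⟨i, hv⟩
    · rintro ((⟨y, a, hv⟩ | ⟨a, hv⟩) | ⟨i, hv⟩)
      · have hpsi : ∀ j i, psi hK Y P.rep j i =
            (a * (conjPoly F L j Q).eval y) * y ^ (i : ℕ) := fun j i => by
          rw [hv, map_smul, Pi.smul_apply, Pi.smul_apply, psi_sum_curveVec hK, smul_eq_mul,
            mul_assoc]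
        refine ⟨⟨_, fun i => y ^ (i : ℕ), by simp, hpsi⟩,
          a * (conjPoly F L 0 (infPoly η β * Q)).eval y, fun j => ?_⟩
        rw [conjForm_infForm_of_psi hK hpsi, ← hHQ j, conjPoly_mul, Polynomial.eval_mul]
        ring
      · have hpsi : ∀ j i, psi hK Y P.rep j i = a * if i = 2 then 1 else 0 := fun j i => by
          rw [hv, map_smul, Pi.smul_apply, Pi.smul_apply, psi_curveVec_last hK Y hQ, smul_eq_mul]
        refine ⟨⟨fun _ => a, fun i => if i = 2 then 1 else 0, by simp, hpsi⟩, a, fun j => ?_⟩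
        rw [conjForm_infForm hK, hpsi, hpsi, hpsi]
        simp
      · obtain ⟨l, hl, hpsi⟩ := (mem_fiberAtInfinity hK).1 hv
        refine ⟨⟨l, fun i => x _ ^ (i : ℕ), by simp, hpsi⟩, 0, fun j => ?_⟩
        rw [conjForm_infForm_of_psi hK hpsi, hl]
  refine ⟨Q.natDegree + 2, by omega, by omega, curveVec Y Q, hli,
    fun i => (hYS _).2 (exists_infForm_curveVec (L := L) Y η β (hHQ 1) i),
    card_sub_one_le_ncard (L := L) Y hQ hHQ hx hli hYi, m,
    fun i => fiberAtInfinity hK Y (infPoly η β) (x i), fun i => ?_,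
    fun i => fiberAtInfinity_le hK hYi (x i), fun i j hij => ?_, ?_,
    points_eq_of_points_eq _ (by omega) hli _ hLpts,
    points_eq_of_points_eq _ (by omega) hli _ hLpts, hLpts⟩
  · have h2 := hx2 i
    have h3 := hle3 (x i)
    rw [hfr]
    omega
  · have h2 := hx2 i
    exact congrArg (fiberAtInfinity hK Y (infPoly η β))
      (eq_of_fiberAtInfinity_le hK (by omega) hij)
  · simpa only [hfr] using hsum
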